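/- Let $N\ge 1$, $0<T<\infty$, let $Y\subseteq\mathbb{R}^d$ and $U\subseteq\mathbb{R}^l$ be bounded and open, equipped with Lebesgue measure, and let $\sigma,h:\mathbb{R}\to\mathbb{R}$ be Lipschitz continuous and differentiable. Let $f_I^{(j)}\in L^2(Y)$ and $P^{(j)}\in L^2(U)$ for $j=1,\dots,N$. For $a\in L^2(Y\times(0,T))$ and $b\in L^2(Y\times Y\times(0,T))$ let $f^{(j)}\in C([0,T];L^2(Y))$ denote the solution of the forward problem $$\partial_t f^{(j)}(y,t)=\sigma\big(\xi^{(j)}(y,t)\big),\qquad \xi^{(j)}(y,t):=a(y,t)-\int_Y b(y,z,t)f^{(j)}(z,t)\,dz,\qquad f^{(j)}(y,0)=f^{(j)}_I(y),$$ understood in integrated form: for a.e. $s\in(0,T)$ the right-hand side $\sigma(\xi^{(j)}(\cdot,s))$ lies in $L^2(Y)$, it is Bochner integrable in $s$ as an $L^2(Y)$-valued function, and $f^{(j)}(t)=f^{(j)}_I+\int_0^t\sigma(\xi^{(j)}(\cdot,s))\,ds$ in $L^2(Y)$ for all $t\in[0,T]$. For $w\in L^2(U\times Y)$ and $\mu\in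 L^2(U)$ put $$Z^{(j)}(u)=\int_Y w(u,y)f^{(j)}(y,T)\,dy+\mu(u),\qquad P^{(j)}_{\mathrm{pre}}(u)=h\big(Z^{(j)}(u)\big),$$ $$J(a,b,w,\mu)=\frac{1}{2N}\sum_{j=1}^N\int_U\big|P^{(j)}_{\mathrm{pre}}(u)-P^{(j)}(u)\big|^2\,du .$$ Let $r^{(j)}\in C([0,T];L^2(Y))$ denote the solution, in the same integrated sense, of the backward problem $$\partial_t r^{(j)}(y,t)=\int_Y b(z,y,t)\,\sigma'\big(\xi^{(j)}(z,t)\big)\,r^{(j)}(z,t)\,dz,\qquad r^{(j)}(y,T)=\int_U\big(P^{(j)}_{\mathrm{pre}}(u)-P^{(j)}(u)\big)h'\big(Z^{(j)}(u)\big)w(u,y)\,du .$$ Then the forward and the backward problems have exactly one solution for all such $a,b,w,\mu$ and all $j$ (so that $J$ is a well-defined functional on $L^2(Y\times(0,T))\times L^2(Y\times Y\times(0,T))\times L^2(U\times Y)\times L^2(U)$), and at every point $(a,b,w,\mu)$ of this space the functions $$D_aJ(y,s)=\frac1N\sum_{j=1}^N\sigma'\big(\xi^{(j)}(y,s)\big)r^{(j)}(y,s),$$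 $$D_bJ(y,z,s)=-\frac1N\sum_{j=1}^N f^{(j)}(z,s)\,\sigma'\big(\xi^{(j)}(y,s)\big)r^{(j)}(y,s),$$ $$D_wJ(u,y)=\frac1N\sum_{j=1}^N\big(P^{(j)}_{\mathrm{pre}}(u)-P^{(j)}(u)\big)h'\big(Z^{(j)}(u)\big)f^{(j)}(y,T),$$ $$D_\mu J(u)=\frac1N\sum_{j=1}^N\big(P^{(j)}_{\mathrm{pre}}(u)-P^{(j)}(u)\big)h'\big(Z^{(j)}(u)\big)$$ (equalities for a.e. argument) satisfy $$(D_aJ,D_bJ,D_wJ,D_\mu J)\in L^2(Y\times(0,T))\times L^2(Y\times Y\times(0,T))\times L^2(U\times Y)\times L^2(U),$$ and $(D_aJ,D_bJ,D_wJ,D_\mu J)$ is the Gateaux derivative of $J$ at $(a,b,w,\mu)$: for every direction $(\alpha,\beta,v,\varphi)$ in this space, $$\frac{d}{d\varepsilon}J(a+\varepsilon\alpha,b+\varepsilon\beta,w+\varepsilon v,\mu+\varepsilon\varphi)\Big|_{\varepsilon=0}=\langle D_aJ,\alpha\rangle_{L^2}+\langle D_bJ,\beta\rangle_{L^2}+\langle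 D_wJ,v\rangle_{L^2}+\langle D_\mu J,\varphi\rangle_{L^2}.$$ In particular, these four functions are the first variations of $J$ with respect to $a$, $b$, $w$ and $\mu$. -/

import Mathlib

open MeasureTheory Set

noncomputable section

namespace DeepIDE

/-- The data of the learning problem: the label domain `Y ⊆ ℝᵈ` of the hidden layers, the label
domain `U ⊆ ℝˡ` of the output layer, the final time `T`, the activation function `σ`, the
prediction function `h`, and the `N` training pairs `(f_I⁽ʲ⁾, P⁽ʲ⁾) ∈ L²(Y) × L²(U)`. -/
structure LearningData (d l N : ℕ) where
  Y : Set (EuclideanSpace ℝ (Fin d))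
  U : Set (EuclideanSpace ℝ (Fin l))
  T : ℝ
  σ : ℝ → ℝ
  h : ℝ → ℝ
  fI : Fin N → Lp ℝ 2 (volume.restrict Y)
  P : Fin N → Lp ℝ 2 (volume.restrict U)

namespace LearningData

variable {d l N : ℕ} (S : LearningData d l N)

/-- Lebesgue measure on `Y`. -/
abbrev μY : Measure (EuclideanSpace ℝ (Fin d)) := volume.restrict S.Y

/-- Lebesgue measure on `U`. -/
abbrev μU : Measure (EuclideanSpace ℝ (Fin l)) := volume.restrict S.U

/-- Lebesgue measure on `(0, T)`. -/
abbrev μT : Measure ℝ := volume.restrict (Ioo 0 S.T)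

/-- `L²(Y)`, the state space. -/
abbrev State := Lp ℝ 2 S.μY

/-- `L²(Y × (0,T))`, the space of the network biases `a(y, t)`. -/
abbrev BiasSpace := Lp ℝ 2 (S.μY.prod S.μT)

/-- `L²(Y × Y × (0,T))`, the space of the network weights `b(y, z, t)`. -/
abbrev WeightSpace := Lp ℝ 2 (S.μY.prod (S.μY.prod S.μT))

/-- `L²(U × Y)`, the space of the terminal weights `w(u, y)`. -/
abbrev OutputWeightSpace := Lp ℝ 2 (S.μU.prod S.μY)

/-- `L²(U)`, the space of the terminal biases `μ(u)`. -/
abbrev OutputBiasSpace := Lp ℝ 2 S.μU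

/-- The space of all training parameters `(a, b, w, μ)`. -/
abbrev Params := S.BiasSpace × S.WeightSpace × S.OutputWeightSpace × S.OutputBiasSpace

/-- `a(y, s) - ∫_Y b(y, z, s) φ(z) dz`; for `φ = f⁽ʲ⁾(·, s)` this is `ξ⁽ʲ⁾(y, s)`. -/
def preActivation (a : S.BiasSpace) (b : S.WeightSpace) (φ : S.State) (s : ℝ)
    (y : EuclideanSpace ℝ (Fin d)) : ℝ :=
  a (y, s) - ∫ z, b (y, z, s) * φ z ∂S.μY

/-- `f ∈ C([0,T]; L²(Y))` solves the forward problem for the `j`-th datum,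
`∂ₜ f(y, t) = σ(a(y, t) - ∫_Y b(y, z, t) f(z, t) dz)`, `f(·, 0) = f_I⁽ʲ⁾`:
`f` is the integral in time of an `L²(Y)`-valued Bochner integrable function `F`
which for a.e. time is the right-hand side. Only the values of `f` on `[0,T]` matter. -/
structure IsForwardSolution (a : S.BiasSpace) (b : S.WeightSpace) (j : Fin N)
    (f : ℝ → S.State) : Prop where
  continuousOn : ContinuousOn f (Icc 0 S.T)
  equation : ∃ F : ℝ → S.State, Integrable F S.μT ∧
    (∀ᵐ s ∂S.μT, F s =ᵐ[S.μY] fun y => S.σ (S.preActivation a b (f s) s y)) ∧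
    ∀ t ∈ Icc 0 S.T, f t = S.fI j + ∫ s in 0..t, F s

/-- The forward solution `f⁽ʲ⁾ = f⁽ʲ⁾_{a,b}`. -/
def forward (a : S.BiasSpace) (b : S.WeightSpace) (j : Fin N) : ℝ → S.State :=
  Classical.epsilon (S.IsForwardSolution a b j)

/-- `ξ⁽ʲ⁾(y, s) = a(y, s) - ∫_Y b(y, z, s) f⁽ʲ⁾(z, s) dz`. -/
def xi (a : S.BiasSpace) (b : S.WeightSpace) (j : Fin N) (y : EuclideanSpace ℝ (Fin d))
    (s : ℝ) : ℝ :=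
  S.preActivation a b (S.forward a b j s) s y

/-- The network output `Z⁽ʲ⁾(u) = ∫_Y w(u, y) f⁽ʲ⁾(y, T) dy + μ(u)`. -/
def output (p : S.Params) (j : Fin N) (u : EuclideanSpace ℝ (Fin l)) : ℝ :=
  match p with
  | (a, b, w, μ) => (∫ y, w (u, y) * S.forward a b j S.T y ∂S.μY) + μ u

/-- The predicted outcome `P_pre⁽ʲ⁾(u) = h(Z⁽ʲ⁾(u))`. -/
def predicted (p : S.Params) (j : Fin N) (u : EuclideanSpace ℝ (Fin l)) : ℝ :=
  S.h (S.output p j u)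

/-- The loss functional `J(a, b, w, μ) = (1 / 2N) ∑ⱼ ∫_U |P_pre⁽ʲ⁾ - P⁽ʲ⁾|² du`. -/
def loss (p : S.Params) : ℝ :=
  1 / (2 * (N : ℝ)) * ∑ j, ∫ u, |S.predicted p j u - S.P j u| ^ 2 ∂S.μU

/-- `(P_pre⁽ʲ⁾(u) - P⁽ʲ⁾(u)) h'(Z⁽ʲ⁾(u))`. -/
def residual (p : S.Params) (j : Fin N) (u : EuclideanSpace ℝ (Fin l)) : ℝ :=
  (S.predicted p j u - S.P j u) * deriv S.h (S.output p j u)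

/-- `r ∈ C([0,T]; L²(Y))` solves the `j`-th backward (adjoint) problem
`∂ₜ r(y, t) = ∫_Y b(z, y, t) σ'(ξ⁽ʲ⁾(z, t)) r(z, t) dz`,
`r(y, T) = ∫_U (P_pre⁽ʲ⁾(u) - P⁽ʲ⁾(u)) h'(Z⁽ʲ⁾(u)) w(u, y) du`,
in the same sense as for the forward problem. -/
structure IsBackwardSolution (p : S.Params) (j : Fin N) (r : ℝ → S.State) : Prop where
  continuousOn : ContinuousOn r (Icc 0 S.T)
  final : r S.T =ᵐ[S.μY] fun y => ∫ u, S.residual p j u * p.2.2.1 (u, y) ∂S.μU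
  equation : ∃ R : ℝ → S.State, Integrable R S.μT ∧
    (∀ᵐ s ∂S.μT, R s =ᵐ[S.μY] fun y =>
      ∫ z, p.2.1 (z, y, s) * (deriv S.σ (S.xi p.1 p.2.1 j z s) * r s z) ∂S.μY) ∧
    ∀ t ∈ Icc 0 S.T, r t = r S.T - ∫ s in t..S.T, R s

end LearningData

end DeepIDE

end

/-! The problem is lifted to the Hilbert space `H = L²(Y)`. There the forward equation reads `x' =
N(A(s) - B(s) x)`, where `N` is the Nemytskii operator of `σ`, `A(s) = a(·, s)`, and `B(s)` is the
Hilbert–Schmidt operator with kernel `b(·, ·, s)`. The coefficients are only square integrable in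
time, so the Lipschitz constant `L ‖B(s)‖` of the right-hand side is merely in `L²(0,T)`. An
exponential weight (`exists_exp_weight`) still makes the Volterra operator a contraction; this gives
existence by Banach's fixed point theorem (`exists_isIntegralSolution`), and uniqueness and
stability by Grönwall's inequality (`exists_gronwall_const`). The backward problem is reduced to
this one by reversing time.

The delicate point is differentiability. On `L²` a Nemytskii operator is in general not Fréchet
differentiable, and `σ'` is not assumed continuous. But `N` is Lipschitz and has a linear derivative
along every line (`hasLineDerivAt_nemytskii`, by dominated convergence), and a Lipschitz map with
line derivatives obeys the chain rule along differentiable curves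
(`hasDerivAt_comp_of_lipschitzWith`). In `hasDerivAt_forward` the same principle is used inside the
integral equation: `N` is linearized only along the fixed direction `η = A' - B' f - B g`, where `g`
solves the linearized equation. The integrated error is `o(ε)` by
`integral_linearization_error_isLittleO`, everything else is absorbed by the Lipschitz bound, and
Grönwall gives `f_ε - f - ε g = o(ε)`.

The gradient comes from duality. Since `N'(ξ)` is a multiplication operator, hence self-adjoint, and
`r' = B* N'(ξ) r`, integration by parts cancels the terms containing `B g` and leaves `⟪g(T), r(T)⟫
= ∫ ⟪A' - B' f, N'(ξ) r⟫ ds` (`inner_linearized_adjoint`). The final value of `r` is the adjoint of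
the output operator applied to the residual, so the left side is the contribution of the hidden
layers to the derivative of the loss. To read the right side as a pairing with functions on `Y ×
(0,T)` and `Y × Y × (0,T)`, `L²(0,T; L²(Y))` is identified with `L²(Y × (0,T))`
(`exists_curryLp_eq`), and a rank-one kernel `p ⊗ q` is paired with `b` through `⟪p, K_b q⟫`
(`inner_tensor_left`). -/

noncomputable section

namespace DeepIDE

open Filter Topology

/-! ### Integral equations whose Lipschitz constant is square integrable in time. -/

section IntegralEquation

variable {H : Type*} [NormedAddCommGroup H]

lemma restrict_Ioc_le_restrict_Ioo {t T : ℝ} (ht : t ≤ T) :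
    (volume : Measure ℝ).restrict (Ioc 0 t) ≤ volume.restrict (Ioo 0 T) := by
  rw [← Measure.restrict_congr_set (Ioo_ae_eq_Ioc (a := (0 : ℝ)) (b := t))]
  exact Measure.restrict_mono (Ioo_subset_Ioo_right ht) le_rfl

lemma intervalIntegrable_of_integrable_Ioo {F : ℝ → H} {t T : ℝ}
    (hF : Integrable F (volume.restrict (Ioo 0 T))) (ht : t ∈ Icc 0 T) :
    IntervalIntegrable F volume 0 t := by
  rw [intervalIntegrable_iff_integrableOn_Ioc_of_le ht.1]
  exact hF.mono_measure (restrict_Ioc_le_restrict_Ioo ht.2)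

lemma ae_mem_Ioc_of_ae_Ioo {P : ℝ → Prop} {t T : ℝ}
    (h : ∀ᵐ s ∂volume.restrict (Ioo 0 T), P s) (ht : t ≤ T) :
    ∀ᵐ s, s ∈ Ioc 0 t → P s :=
  (ae_restrict_iff' measurableSet_Ioc).1 (ae_mono (restrict_Ioc_le_restrict_Ioo ht) h)

lemma norm_integral_le_of_ae_Ioo [NormedSpace ℝ H] {F : ℝ → H} {w : ℝ → ℝ} {t T : ℝ}
    (h : ∀ᵐ s ∂volume.restrict (Ioo 0 T), ‖F s‖ ≤ w s)
    (hw : Integrable w (volume.restrict (Ioo 0 T))) (ht : t ∈ Icc 0 T) :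
    ‖∫ s in 0..t, F s‖ ≤ ∫ s in 0..t, w s :=
  intervalIntegral.norm_integral_le_of_norm_le ht.1 (ae_mem_Ioc_of_ae_Ioo h ht.2)
    (intervalIntegrable_of_integrable_Ioo hw ht)

lemma integral_le_integral_of_ae_Ioo {v w : ℝ → ℝ} {t T : ℝ}
    (h : ∀ᵐ s ∂volume.restrict (Ioo 0 T), v s ≤ w s)
    (hv : Integrable v (volume.restrict (Ioo 0 T)))
    (hw : Integrable w (volume.restrict (Ioo 0 T))) (ht : t ∈ Icc 0 T) :
    ∫ s in 0..t, v s ≤ ∫ s in 0..t, w s := by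
  refine intervalIntegral.integral_mono_ae_restrict ht.1
    (intervalIntegrable_of_integrable_Ioo hv ht) (intervalIntegrable_of_integrable_Ioo hw ht) ?_
  have := ae_mono (restrict_Ioc_le_restrict_Ioo ht.2) h
  rwa [← Measure.restrict_congr_set (Ioc_ae_eq_Icc (a := (0 : ℝ)) (b := t))]

lemma integral_zero_le_integral_Ioo {w : ℝ → ℝ} {t T : ℝ}
    (hw : Integrable w (volume.restrict (Ioo 0 T)))
    (hw0 : ∀ᵐ s ∂volume.restrict (Ioo 0 T), 0 ≤ w s) (ht : t ∈ Icc 0 T) :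
    ∫ s in 0..t, w s ≤ ∫ s in Ioo 0 T, w s := by
  rw [intervalIntegral.integral_of_le ht.1]
  exact integral_mono_measure (restrict_Ioc_le_restrict_Ioo ht.2) hw0 hw

lemma aestronglyMeasurable_Ioo_of_continuousOn {x : ℝ → H} {T : ℝ}
    (hx : ContinuousOn x (Icc 0 T)) :
    AEStronglyMeasurable x (volume.restrict (Ioo 0 T)) :=
  (hx.mono Ioo_subset_Icc_self).aestronglyMeasurable measurableSet_Ioo

lemma memLp_top_of_continuousOn {x : ℝ → H} {T : ℝ} (hx : ContinuousOn x (Icc 0 T)) :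
    MemLp x ⊤ (volume.restrict (Ioo 0 T)) := by
  obtain ⟨C, hC⟩ := isCompact_Icc.exists_bound_of_continuousOn hx
  refine memLp_top_of_bound (aestronglyMeasurable_Ioo_of_continuousOn hx) C ?_
  filter_upwards [ae_restrict_mem measurableSet_Ioo] with s hs
  exact hC s (Ioo_subset_Icc_self hs)

lemma integral_exp_weight {c : ℝ} (hc : 0 < c) (t : ℝ) :
    ∫ s in 0..t, Real.exp (-(c * (t - s))) ≤ 1 / c := by
  have h : ∀ s ∈ uIcc 0 t, HasDerivAt (fun s => Real.exp (-(c * (t - s))) / c)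
      (Real.exp (-(c * (t - s)))) s := by
    intro s _
    have h1 : HasDerivAt (fun s => -(c * (t - s))) c s := by
      convert! (((hasDerivAt_id s).const_sub t).const_mul c).neg using 1
      simp
    convert! (h1.exp.div_const c) using 1
    field_simp
  rw [intervalIntegral.integral_eq_sub_of_hasDerivAt h
    (Continuous.intervalIntegrable (by fun_prop) _ _)]
  have : 0 < Real.exp (-(c * (t - 0))) / c := by positivity
  simp only [sub_self, mul_zero, neg_zero, Real.exp_zero]
  linarith

/-- An exponential weight that makes the Volterra operator with kernel `k ∈ L²(0,T)`
a contraction. -/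
lemma exists_exp_weight {k : ℝ → ℝ} {T : ℝ}
    (hk : MemLp k 2 (volume.restrict (Ioo 0 T))) :
    ∃ c : ℝ, 0 < c ∧ ∀ t ∈ Icc 0 T, ∫ s in 0..t, k s * Real.exp (-(c * (t - s))) ≤ 1 / 2 := by
  set K : ℝ := ∫ s in Ioo 0 T, k s ^ 2 with hK
  have hK0 : 0 ≤ K := integral_nonneg fun s => sq_nonneg _
  have hk2 : Integrable (fun s => k s ^ 2) (volume.restrict (Ioo 0 T)) := hk.integrable_sq
  -- Young's inequality `k e ≤ k² / (4 (K + 1)) + (K + 1) e²` is integrated below. With this rate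
  -- each of the two terms contributes at most 1/4; `K + 1` in place of `K` avoids dividing by zero
  -- when `k` vanishes.
  refine ⟨2 * (K + 1), by positivity, fun t ht => ?_⟩
  set c := 2 * (K + 1) with hc
  have hexp : ∀ c : ℝ, MemLp (fun s => Real.exp (-(c * (t - s)))) ⊤
      (volume.restrict (Ioo 0 T)) := fun c =>
    memLp_top_of_continuousOn (Continuous.continuousOn (by fun_prop))
  have hki : Integrable (fun s => k s * Real.exp (-(c * (t - s)))) (volume.restrict (Ioo 0 T)) :=
    (hk.integrable (by norm_num)).mul_of_top_left (hexp c)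
  have hei : Integrable (fun s => Real.exp (-(2 * c * (t - s)))) (volume.restrict (Ioo 0 T)) :=
    (hexp (2 * c)).integrable le_top
  calc ∫ s in 0..t, k s * Real.exp (-(c * (t - s)))
      ≤ ∫ s in 0..t, (1 / (4 * (K + 1)) * k s ^ 2 + (K + 1) * Real.exp (-(2 * c * (t - s)))) := by
        refine integral_le_integral_of_ae_Ioo (ae_of_all _ fun s => ?_) hki
          ((hk2.const_mul _).add (hei.const_mul _)) ht
        have h1 : Real.exp (-(2 * c * (t - s))) = Real.exp (-(c * (t - s))) ^ 2 := by
          rw [← Real.exp_nat_mul]; congr 1; push_cast; ring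
        rw [h1]
        set e := Real.exp (-(c * (t - s)))
        have hp : 0 < K + 1 := by linarith
        have h2 : 1 / (4 * (K + 1)) * k s ^ 2 + (K + 1) * e ^ 2 - k s * e
            = (K + 1) * (k s / (2 * (K + 1)) - e) ^ 2 := by
          field_simp
          ring
        have h3 : 0 ≤ (K + 1) * (k s / (2 * (K + 1)) - e) ^ 2 := by positivity
        linarith
    _ = 1 / (4 * (K + 1)) * (∫ s in 0..t, k s ^ 2)
          + (K + 1) * ∫ s in 0..t, Real.exp (-(2 * c * (t - s))) := by
        rw [intervalIntegral.integral_add, intervalIntegral.integral_const_mul,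
          intervalIntegral.integral_const_mul]
        · exact (intervalIntegrable_of_integrable_Ioo hk2 ht).const_mul _
        · exact (intervalIntegrable_of_integrable_Ioo hei ht).const_mul _
    _ ≤ 1 / (4 * (K + 1)) * (K + 1) + (K + 1) * (1 / (2 * c)) := by
        gcongr
        · exact (integral_zero_le_integral_Ioo hk2 (ae_of_all _ fun s => sq_nonneg _) ht).trans
            (by linarith)
        · exact integral_exp_weight (by positivity) t
    _ = 1 / 2 := by
        rw [hc]; field_simp; norm_num

/-- Grönwall's inequality with a square integrable kernel. -/
lemma exists_gronwall_const {k : ℝ → ℝ} {T : ℝ}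
    (hk : MemLp k 2 (volume.restrict (Ioo 0 T))) (hk0 : ∀ s, 0 ≤ k s) :
    ∃ C : ℝ, 0 ≤ C ∧ ∀ c : ℝ, 0 ≤ c → ∀ v : ℝ → ℝ, ContinuousOn v (Icc 0 T) →
      (∀ t ∈ Icc 0 T, v t ≤ c + ∫ s in 0..t, k s * v s) → ∀ t ∈ Icc 0 T, v t ≤ C * c := by
  obtain ⟨l, hl, hw⟩ := exists_exp_weight hk
  -- The constant depends on `k` and `T` only, so it can later be used uniformly for a family `v =
  -- v_ε` with `c = c_ε → 0`.
  refine ⟨2 * Real.exp (l * T), by positivity, fun c hc v hv h t ht => ?_⟩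
  have hcont : ContinuousOn (fun s => Real.exp (-(l * s)) * v s) (Icc 0 T) :=
    (Continuous.continuousOn (by fun_prop)).mul hv
  -- At a maximum point of the weighted function the hypothesis gives `M ≤ c + M / 2`, hence `M ≤ 2
  -- c`.
  obtain ⟨t₀, ht₀, hmax⟩ := isCompact_Icc.exists_isMaxOn ⟨t, ht⟩ hcont
  set M := Real.exp (-(l * t₀)) * v t₀ with hM
  have hvM : ∀ s ∈ Icc 0 T, v s ≤ M * Real.exp (l * s) := by
    intro s hs
    have h1 : Real.exp (-(l * s)) * v s ≤ M := hmax hs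
    calc v s = Real.exp (-(l * s)) * v s * Real.exp (l * s) := by
          rw [mul_right_comm, ← Real.exp_add]; simp
      _ ≤ M * Real.exp (l * s) := by gcongr
  have hki : Integrable k (volume.restrict (Ioo 0 T)) := hk.integrable (by norm_num)
  have hM2 : M ≤ 2 * c := by
    rcases le_or_gt M 0 with hM0 | hM0
    · linarith
    have h2 : v t₀ ≤ c + ∫ s in 0..t₀, k s * (M * Real.exp (l * s)) := by
      refine (h t₀ ht₀).trans (add_le_add le_rfl ?_)
      refine integral_le_integral_of_ae_Ioo ?_ (hki.mul_of_top_left (memLp_top_of_continuousOn hv))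
        (hki.mul_of_top_left (memLp_top_of_continuousOn
          (Continuous.continuousOn (by fun_prop)))) ht₀
      filter_upwards [ae_restrict_mem measurableSet_Ioo] with s hs
      exact mul_le_mul_of_nonneg_left (hvM s (Ioo_subset_Icc_self hs)) (hk0 s)
    have h3 : Real.exp (-(l * t₀)) * ∫ s in 0..t₀, k s * (M * Real.exp (l * s))
        = M * ∫ s in 0..t₀, k s * Real.exp (-(l * (t₀ - s))) := by
      rw [← intervalIntegral.integral_const_mul, ← intervalIntegral.integral_const_mul]
      congr 1; ext s
      have : Real.exp (-(l * (t₀ - s))) = Real.exp (-(l * t₀)) * Real.exp (l * s) := by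
        rw [← Real.exp_add]; congr 1; ring
      rw [this]; ring
    have h4 : M ≤ Real.exp (-(l * t₀)) * c + M * (1 / 2) := by
      calc M ≤ Real.exp (-(l * t₀)) * (c + ∫ s in 0..t₀, k s * (M * Real.exp (l * s))) := by
            rw [hM]; gcongr
        _ = Real.exp (-(l * t₀)) * c + M * ∫ s in 0..t₀, k s * Real.exp (-(l * (t₀ - s))) := by
            rw [mul_add, h3]
        _ ≤ _ := by
            gcongr
            exact hw t₀ ht₀
    have h5 : Real.exp (-(l * t₀)) * c ≤ c := by
      have : Real.exp (-(l * t₀)) ≤ 1 := by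
        rw [Real.exp_le_one_iff]; have := mul_nonneg hl.le ht₀.1; linarith
      nlinarith
    linarith
  calc v t ≤ M * Real.exp (l * t) := hvM t ht
    _ ≤ 2 * c * Real.exp (l * t) := by gcongr
    _ ≤ 2 * c * Real.exp (l * T) := by
        gcongr
        exact ht.2
    _ = _ := by ring

variable [NormedSpace ℝ H]

/-- `x` solves `x' = G(t, x)`, `x(0) = x₀` on `[0,T]`, in integrated form. -/
structure IsIntegralSolution (T : ℝ) (G : ℝ → H → H) (x₀ : H) (x : ℝ → H) : Prop where
  continuousOn : ContinuousOn x (Icc 0 T)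
  integrable : Integrable (fun s => G s (x s)) (volume.restrict (Ioo 0 T))
  eq : ∀ t ∈ Icc 0 T, x t = x₀ + ∫ s in 0..t, G s (x s)

lemma IsIntegralSolution.eqOn {T : ℝ} {G : ℝ → H → H} {k : ℝ → ℝ} {x₀ : H} {x y : ℝ → H}
    (hk : MemLp k 2 (volume.restrict (Ioo 0 T))) (hk0 : ∀ s, 0 ≤ k s)
    (hG : ∀ᵐ s ∂volume.restrict (Ioo 0 T), ∀ x y, ‖G s x - G s y‖ ≤ k s * ‖x - y‖)
    (hx : IsIntegralSolution T G x₀ x) (hy : IsIntegralSolution T G x₀ y) :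
    EqOn x y (Icc 0 T) := by
  obtain ⟨C, -, hC⟩ := exists_gronwall_const hk hk0
  intro t ht
  have hcont : ContinuousOn (fun t => ‖x t - y t‖) (Icc 0 T) :=
    (hx.continuousOn.sub hy.continuousOn).norm
  have := hC 0 le_rfl (fun t => ‖x t - y t‖) hcont (fun t ht => ?_) t ht
  · rw [mul_zero] at this
    exact sub_eq_zero.1 (norm_le_zero_iff.1 this)
  · rw [zero_add, hx.eq t ht, hy.eq t ht, add_sub_add_left_eq_sub,
      ← intervalIntegral.integral_sub (intervalIntegrable_of_integrable_Ioo hx.integrable ht)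
        (intervalIntegrable_of_integrable_Ioo hy.integrable ht)]
    refine norm_integral_le_of_ae_Ioo ?_ ?_ ht
    · filter_upwards [hG] with s hs using hs _ _
    · exact (hk.integrable (by norm_num)).mul_of_top_left (memLp_top_of_continuousOn hcont)

/-- Banach's fixed point theorem in `C([0,T]; H)` after the substitution `x(t) = exp(l t) g(t)`.
With the weight of `exists_exp_weight` the conjugated Picard map contracts by 1/2 on the whole
interval, so no gluing of local solutions is needed. -/
lemma exists_isIntegralSolution [CompleteSpace H] {T : ℝ} (hT : 0 ≤ T) {G : ℝ → H → H}
    {k : ℝ → ℝ} (x₀ : H)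
    (hk : MemLp k 2 (volume.restrict (Ioo 0 T)))
    (hG : ∀ᵐ s ∂volume.restrict (Ioo 0 T), ∀ x y, ‖G s x - G s y‖ ≤ k s * ‖x - y‖)
    (hGi : ∀ x : ℝ → H, ContinuousOn x (Icc 0 T) →
      Integrable (fun s => G s (x s)) (volume.restrict (Ioo 0 T))) :
    ∃ x, IsIntegralSolution T G x₀ x := by
  obtain ⟨l, hl, hw⟩ := exists_exp_weight hk
  let E : C(Icc (0 : ℝ) T, H) → ℝ → H := fun g s => Real.exp (l * s) • g (projIcc 0 T hT s)
  have hE : ∀ g, Continuous (E g) := fun g => by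
    have : Continuous (projIcc 0 T hT) := continuous_projIcc
    fun_prop
  have hEi : ∀ g, Integrable (fun s => G s (E g s)) (volume.restrict (Ioo 0 T)) := fun g =>
    hGi _ (hE g).continuousOn
  have hprim : ∀ g, ContinuousOn (fun t => ∫ s in 0..t, G s (E g s)) (Icc 0 T) := fun g => by
    have h : IntegrableOn (fun s => G s (E g s)) (uIcc 0 T) := by
      rw [uIcc_of_le hT]
      exact (integrableOn_Icc_iff_integrableOn_Ioo (a := 0) (b := T)).2 (hEi g)
    have h' := intervalIntegral.continuousOn_primitive_interval h
    rwa [uIcc_of_le hT] at h'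
  let Ψ : C(Icc (0 : ℝ) T, H) → C(Icc (0 : ℝ) T, H) := fun g =>
    ⟨fun t => Real.exp (-(l * t)) • (x₀ + ∫ s in 0..(t : ℝ), G s (E g s)), by
      have := (hprim g).domRestrict
      simp only [domRestrict_def] at this
      fun_prop⟩
  have hΨ : ContractingWith (1 / 2) Ψ := by
    refine ⟨by rw [← NNReal.coe_lt_coe]; norm_num, LipschitzWith.of_dist_le_mul fun g g' => ?_⟩
    rw [ContinuousMap.dist_le (by positivity)]
    rintro ⟨t, ht⟩
    simp only [Ψ, ContinuousMap.coe_mk]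
    rw [dist_eq_norm, ← smul_sub, add_sub_add_left_eq_sub, norm_smul, Real.norm_eq_abs,
      abs_of_pos (Real.exp_pos _),
      ← intervalIntegral.integral_sub (intervalIntegrable_of_integrable_Ioo (hEi g) ht)
        (intervalIntegrable_of_integrable_Ioo (hEi g') ht)]
    have h1 : ‖∫ s in 0..t, G s (E g s) - G s (E g' s)‖
        ≤ ∫ s in 0..t, k s * (Real.exp (l * s) * dist g g') := by
      refine norm_integral_le_of_ae_Ioo ?_ ?_ ht
      -- The sign of `k` is forced by the Lipschitz bound as soon as two distinct points are
      -- available; for `g = g'` the estimate is trivial.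
      · have hk0 : ∀ᵐ s ∂volume.restrict (Ioo 0 T), ∀ x y : H, x ≠ y → 0 ≤ k s := by
          filter_upwards [hG] with s hs x y hxy
          have h2 := (norm_nonneg _).trans (hs x y)
          exact nonneg_of_mul_nonneg_left h2 (norm_pos_iff.2 (sub_ne_zero.2 hxy))
        filter_upwards [hG, hk0] with s hs hks
        refine (hs _ _).trans ?_
        by_cases hgg : g = g'
        · subst hgg; simp
        obtain ⟨u, hu⟩ : ∃ u, g u ≠ g' u := by
          by_contra! hcon
          exact hgg (ContinuousMap.ext hcon)
        refine mul_le_mul_of_nonneg_left ?_ (hks _ _ hu)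
        simp only [E]
        rw [← smul_sub, norm_smul, Real.norm_eq_abs, abs_of_pos (Real.exp_pos _), ← dist_eq_norm]
        gcongr
        exact ContinuousMap.dist_apply_le_dist _
      · exact (hk.integrable (by norm_num)).mul_of_top_left
          (memLp_top_of_continuousOn (Continuous.continuousOn (by fun_prop)))
    calc Real.exp (-(l * t)) * ‖∫ s in 0..t, G s (E g s) - G s (E g' s)‖
        ≤ Real.exp (-(l * t)) * ∫ s in 0..t, k s * (Real.exp (l * s) * dist g g') := by gcongr
      _ = dist g g' * ∫ s in 0..t, k s * Real.exp (-(l * (t - s))) := by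
          rw [← intervalIntegral.integral_const_mul, ← intervalIntegral.integral_const_mul]
          congr 1; ext s
          have : Real.exp (-(l * (t - s))) = Real.exp (-(l * t)) * Real.exp (l * s) := by
            rw [← Real.exp_add]; congr 1; ring
          rw [this]; ring
      _ ≤ dist g g' * (1 / 2) := by gcongr; exact hw t ht
      _ = _ := by push_cast; ring
  have : Nonempty C(Icc (0 : ℝ) T, H) := ⟨0⟩
  set g := hΨ.fixedPoint Ψ with hg
  have hfix : Ψ g = g := hΨ.fixedPoint_isFixedPt
  refine ⟨E g, (hE g).continuousOn, hEi g, fun t ht => ?_⟩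
  have h1 : g ⟨t, ht⟩ = Real.exp (-(l * t)) • (x₀ + ∫ s in 0..t, G s (E g s)) := by
    conv_lhs => rw [← hfix]
    rfl
  have h2 : E g t = Real.exp (l * t) • g ⟨t, ht⟩ := by
    simp only [E, projIcc_of_mem hT ht]
  rw [h2, h1, smul_smul, ← Real.exp_add]
  simp

end IntegralEquation

/-! ### Integration by parts for primitives of Bochner integrable functions. -/

section IntegrationByParts

variable {H : Type*} [NormedAddCommGroup H] [InnerProductSpace ℝ H] [CompleteSpace H]

open scoped RealInnerProductSpace

/-- Integration by parts for the pairing of `g(t) = ∫₀ᵗ G` and `r(t) = r(T) - ∫ₜᵀ R`. -/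
lemma inner_eq_integral_of_primitives {T : ℝ} (hT : 0 ≤ T) {G R g r : ℝ → H}
    (hG : Integrable G (volume.restrict (Ioo 0 T))) (hR : Integrable R (volume.restrict (Ioo 0 T)))
    (hg : ∀ t ∈ Icc 0 T, g t = ∫ s in 0..t, G s)
    (hr : ∀ t ∈ Icc 0 T, r t = r T - ∫ s in t..T, R s) :
    ⟪g T, r T⟫ = ∫ s in Ioo 0 T, (⟪G s, r s⟫ + ⟪g s, R s⟫) := by
  set ν := (volume : Measure ℝ).restrict (Ioo 0 T) with hν
  -- Instead of differentiating a product, both pairings are written as integrals of `⟪G s, R t⟫`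
  -- over the triangle `s ≤ t`. They enter with opposite signs and cancel by Fubini, leaving `∫ ⟪G
  -- s, r T⟫ = ⟪g T, r T⟫`.
  have hGR : Integrable (fun p : ℝ × ℝ => ⟪G p.1, R p.2⟫) (ν.prod ν) := by
    refine Integrable.mono' (hG.norm.mul_prod hR.norm)
      ((hG.1.comp_fst).inner (hR.1.comp_snd)) (ae_of_all _ fun p => ?_)
    exact norm_inner_le_norm _ _
  have hS : MeasurableSet {p : ℝ × ℝ | p.1 ≤ p.2} := measurableSet_le measurable_fst measurable_snd
  have hGRS := hGR.indicator hS
  have hswap := integral_integral_swap (f := fun s t : ℝ =>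
    ({p : ℝ × ℝ | p.1 ≤ p.2}.indicator (fun p : ℝ × ℝ => ⟪G p.1, R p.2⟫) (s, t))) hGRS
  have hmem : ∀ᵐ s ∂ν, s ∈ Ioo 0 T := ae_restrict_mem measurableSet_Ioo
  have h1 : ∀ s ∈ Ioo 0 T, ⟪G s, r s⟫ = ⟪G s, r T⟫ - ∫ t, {p : ℝ × ℝ | p.1 ≤ p.2}.indicator
      (fun p : ℝ × ℝ => ⟪G p.1, R p.2⟫) (s, t) ∂ν := by
    intro s hs
    have hRs : IntegrableOn R (Ioc s T) := by
      rw [integrableOn_Ioc_iff_integrableOn_Ioo]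
      exact IntegrableOn.mono_set hR (Ioo_subset_Ioo_left hs.1.le)
    have : (∫ t, {p : ℝ × ℝ | p.1 ≤ p.2}.indicator
        (fun p : ℝ × ℝ => ⟪G p.1, R p.2⟫) (s, t) ∂ν) = ∫ t in s..T, ⟪G s, R t⟫ := by
      -- `Ici s ∩ Ioo 0 T` is half-open on the other side, hence the change of endpoints.
      rw [intervalIntegral.integral_of_le hs.2.le, ← integral_Icc_eq_integral_Ioc,
        integral_Icc_eq_integral_Ico]
      have e1 : ∀ t, {p : ℝ × ℝ | p.1 ≤ p.2}.indicator
          (fun p : ℝ × ℝ => ⟪G p.1, R p.2⟫) (s, t) = (Ici s).indicator (fun t => ⟪G s, R t⟫) t := by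
        intro t; simp [indicator]
      simp_rw [e1]
      rw [integral_indicator measurableSet_Ici, hν, Measure.restrict_restrict measurableSet_Ici]
      congr 2
      ext t; simp only [mem_inter_iff, mem_Ici, mem_Ioo, mem_Ico]
      constructor
      · rintro ⟨h, -, h'⟩; exact ⟨h, h'⟩
      · rintro ⟨h, h'⟩; exact ⟨h, hs.1.trans_le h, h'⟩
    rw [this, hr s ⟨hs.1.le, hs.2.le⟩, inner_sub_right, intervalIntegral.integral_of_le hs.2.le,
      intervalIntegral.integral_of_le hs.2.le, integral_inner hRs]
  have h2 : ∀ t ∈ Ioo 0 T, ⟪g t, R t⟫ = ∫ s, {p : ℝ × ℝ | p.1 ≤ p.2}.indicator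
      (fun p : ℝ × ℝ => ⟪G p.1, R p.2⟫) (s, t) ∂ν := by
    intro t ht
    have hGs : IntegrableOn G (Ioc 0 t) :=
      hG.mono_measure (restrict_Ioc_le_restrict_Ioo ht.2.le)
    have e1 : ∀ s, {p : ℝ × ℝ | p.1 ≤ p.2}.indicator
        (fun p : ℝ × ℝ => ⟪G p.1, R p.2⟫) (s, t) = (Iic t).indicator (fun s => ⟪G s, R t⟫) s := by
      intro s; simp [indicator]
    simp_rw [e1]
    rw [integral_indicator measurableSet_Iic, hν, Measure.restrict_restrict measurableSet_Iic,
      hg t ⟨ht.1.le, ht.2.le⟩, intervalIntegral.integral_of_le ht.1.le, real_inner_comm,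
      ← integral_inner hGs]
    simp_rw [real_inner_comm]
    congr 2
    ext s; simp only [mem_inter_iff, mem_Iic, mem_Ioo, mem_Ioc]
    constructor
    · rintro ⟨h, h'⟩; exact ⟨h', h, h'.trans_lt ht.2⟩
    · rintro ⟨h, h', -⟩; exact ⟨h', h⟩
  have i1 : Integrable (fun s => ⟪G s, r T⟫) ν := hG.inner_const _
  have i2 := hGRS.integral_prod_left
  have i3 := hGRS.integral_prod_right
  have e : ∀ᵐ s ∂ν, ⟪G s, r s⟫ + ⟪g s, R s⟫ = (⟪G s, r T⟫ - ∫ t, {p : ℝ × ℝ | p.1 ≤ p.2}.indicator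
      (fun p : ℝ × ℝ => ⟪G p.1, R p.2⟫) (s, t) ∂ν) + ∫ t, {p : ℝ × ℝ | p.1 ≤ p.2}.indicator
      (fun p : ℝ × ℝ => ⟪G p.1, R p.2⟫) (t, s) ∂ν := by
    filter_upwards [hmem] with s hs
    rw [h1 s hs, h2 s hs]
  have i12 := integral_add (i1.sub i2) i3
  simp only [Pi.sub_apply] at i12
  rw [integral_congr_ae e, i12, integral_sub i1 i2, hswap, sub_add_cancel,
    hg T ⟨hT, le_rfl⟩, intervalIntegral.integral_of_le hT, integral_Ioc_eq_integral_Ioo,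
    real_inner_comm, ← integral_inner hG]
  simp_rw [real_inner_comm]

end IntegrationByParts

end DeepIDE

end

noncomputable section

namespace DeepIDE

open Filter Topology
open scoped NNReal

/-! ### Calculus of Lipschitz maps that are differentiable along lines. -/

section LipschitzGateaux

variable {V W : Type*} [NormedAddCommGroup V] [NormedSpace ℝ V]
  [NormedAddCommGroup W] [NormedSpace ℝ W]

/-- Chain rule for a Lipschitz map that is differentiable along the line `y 0 + ℝ y'`. -/
lemma hasDerivAt_comp_of_lipschitzWith {L : ℝ≥0} {N : V → W} (hN : LipschitzWith L N)
    {y : ℝ → V} {y' : V} {n : W} (hy : HasDerivAt y y' 0) (hn : HasLineDerivAt ℝ N n (y 0) y') :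
    HasDerivAt (fun ε => N (y ε)) n 0 := by
  rw [hasDerivAt_iff_isLittleO_nhds_zero] at hy ⊢
  have hn' := (hasDerivAt_iff_isLittleO_nhds_zero (f := fun t : ℝ => N (y 0 + t • y'))).1 hn
  simp only [zero_add, zero_smul, add_zero] at hy hn' ⊢
  -- The curve is within `o(h)` of its tangent line, and the Lipschitz map `N` preserves this order;
  -- on the tangent line itself the line derivative applies.
  have h1 : (fun h => N (y h) - N (y 0 + h • y')) =o[𝓝 0] fun h : ℝ => h := by
    refine Asymptotics.IsBigO.trans_isLittleO (Asymptotics.IsBigO.of_bound L ?_) hy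
    refine Eventually.of_forall fun h => ?_
    have := hN.norm_sub_le (y h) (y 0 + h • y')
    rwa [← sub_sub] at this
  refine (h1.add hn').congr_left fun h => ?_
  abel

lemma norm_le_of_lipschitzWith_of_hasLineDerivAt {L : ℝ≥0} {N : V → W} (hN : LipschitzWith L N)
    {x h : V} {n : W} (hn : HasLineDerivAt ℝ N n x h) : ‖n‖ ≤ L * ‖h‖ := by
  have h1 : LipschitzWith (L * ‖h‖₊) fun t : ℝ => N (x + t • h) := by
    refine hN.comp (LipschitzWith.of_dist_le_mul fun s t => ?_)
    rw [dist_add_left, dist_eq_norm, ← sub_smul, norm_smul, dist_eq_norm, mul_comm, coe_nnnorm]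
  have h2 := HasDerivAt.le_of_lipschitz hn h1
  simpa using h2

variable {α : Type*} [MeasurableSpace α] {ν : Measure α}

/-- The derivative is the limit of difference quotients with step `1 / (k + 1)`, each measurable
because `N` is continuous. Thus no regularity of the derivative in its base point is needed. -/
lemma aestronglyMeasurable_of_hasLineDerivAt {N : V → W} (hN : Continuous N)
    {x h : α → V} {n : α → W} (hx : AEStronglyMeasurable x ν) (hh : AEStronglyMeasurable h ν)
    (hn : ∀ᵐ s ∂ν, HasLineDerivAt ℝ N (n s) (x s) (h s)) : AEStronglyMeasurable n ν := by
  refine aestronglyMeasurable_of_tendsto_ae atTop (f := fun (k : ℕ) s =>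
    ((1 / ((k : ℝ) + 1))⁻¹) • (N (x s + (1 / ((k : ℝ) + 1)) • h s) - N (x s))) (fun k => ?_) ?_
  · exact ((hN.comp_aestronglyMeasurable (hx.add (hh.const_smul _))).sub
      (hN.comp_aestronglyMeasurable hx)).const_smul _
  · filter_upwards [hn] with s hs
    have h1 := (hasDerivAt_iff_tendsto_slope_zero.1
      (hs : HasDerivAt (fun t : ℝ => N (x s + t • h s)) (n s) 0))
    simp only [zero_add, zero_smul, add_zero] at h1
    refine h1.comp (tendsto_nhdsWithin_iff.2 ⟨tendsto_one_div_add_atTop_nhds_zero_nat, ?_⟩)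
    refine Eventually.of_forall fun k => ?_
    have : (0 : ℝ) < 1 / ((k : ℝ) + 1) := by positivity
    exact this.ne'

/-- The integrated linearization error along a direction field is `o(ε)`. -/
lemma integral_linearization_error_isLittleO {L : ℝ≥0} {N : V → W} (hN : LipschitzWith L N)
    {x h : α → V} {n : α → W} (hx : AEStronglyMeasurable x ν) (hh : Integrable h ν)
    (hn : ∀ᵐ s ∂ν, HasLineDerivAt ℝ N (n s) (x s) (h s)) :
    (fun ε : ℝ => ∫ s, ‖N (x s + ε • h s) - N (x s) - ε • n s‖ ∂ν) =o[𝓝 0] fun ε => ε := by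
  have hnm := aestronglyMeasurable_of_hasLineDerivAt hN.continuous hx hh.1 hn
  rw [Asymptotics.isLittleO_iff_tendsto (by rintro ε rfl; simp)]
  have h0 : ∀ ε : ℝ, (∫ s, ‖N (x s + ε • h s) - N (x s) - ε • n s‖ ∂ν) / ε
      = ∫ s, ‖N (x s + ε • h s) - N (x s) - ε • n s‖ / ε ∂ν := fun ε =>
    (integral_div _ _).symm
  simp_rw [h0]
  suffices h : Tendsto (fun ε : ℝ => ∫ s, ‖N (x s + ε • h s) - N (x s) - ε • n s‖ / ε ∂ν) (𝓝 0)
      (𝓝 (∫ _, (0 : ℝ) ∂ν)) by simpa only [integral_zero] using h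
  -- The increment and the linear term are each at most `L |ε| ‖h s‖`, which yields the majorant;
  -- pointwise convergence is the line derivative. At `ε = 0` the quotient is 0 by convention.
  refine tendsto_integral_filter_of_dominated_convergence (fun s => 2 * L * ‖h s‖) ?_ ?_
    (hh.norm.const_mul _) ?_
  · refine Eventually.of_forall fun ε => ?_
    simp_rw [div_eq_mul_inv]
    exact ((((hN.continuous.comp_aestronglyMeasurable (hx.add (hh.1.const_smul ε))).sub
      (hN.continuous.comp_aestronglyMeasurable hx)).sub (hnm.const_smul ε)).norm).mul_const _
  · refine Eventually.of_forall fun ε => ?_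
    filter_upwards [hn] with s hs
    have h1 := norm_le_of_lipschitzWith_of_hasLineDerivAt hN hs
    have h2 := hN.norm_sub_le (x s + ε • h s) (x s)
    rw [add_sub_cancel_left, norm_smul] at h2
    rw [norm_div, norm_norm]
    refine div_le_of_le_mul₀ (norm_nonneg _) (by positivity) ?_
    calc ‖N (x s + ε • h s) - N (x s) - ε • n s‖
        ≤ ‖N (x s + ε • h s) - N (x s)‖ + ‖ε • n s‖ := norm_sub_le _ _
      _ ≤ L * (‖ε‖ * ‖h s‖) + ‖ε‖ * (L * ‖h s‖) := by
          rw [norm_smul]; gcongr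
      _ = _ := by ring
  · filter_upwards [hn] with s hs
    have hs' := (hasDerivAt_iff_isLittleO_nhds_zero (f := fun t : ℝ => N (x s + t • h s))).1 hs
    simp only [zero_add, zero_smul, add_zero] at hs'
    exact hs'.norm_left.tendsto_div_nhds_zero

end LipschitzGateaux

/-! ### Differentiability of the abstract forward solution in its parameters. -/

section Sensitivity

variable {H : Type*} [NormedAddCommGroup H]

/-- Linear growth `‖N x‖ ≤ ‖N 0‖ + L ‖x‖`; finiteness of the measure handles the constant. It serves
both for real functions in the space variable and for `H`-valued paths in time. -/
lemma memLp_comp_of_lipschitzWith {L : ℝ≥0} {N : H → H} (hN : LipschitzWith L N)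
    {α : Type*} [MeasurableSpace α] {ν : Measure α} [IsFiniteMeasure ν] {x : α → H}
    (hx : MemLp x 2 ν) : MemLp (fun s => N (x s)) 2 ν := by
  have h0 : MemLp (fun _ : α => ‖N 0‖) 2 ν := memLp_const _
  refine (h0.add (hx.norm.const_mul (L : ℝ))).mono'
    (hN.continuous.comp_aestronglyMeasurable hx.1) (ae_of_all _ fun s => ?_)
  have h1 := hN.norm_sub_le (x s) 0
  rw [sub_zero] at h1
  have h2 := norm_le_norm_add_norm_sub (N 0) (N (x s))
  rw [norm_sub_rev] at h2
  simp only [Pi.add_apply]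
  exact h2.trans (add_le_add le_rfl h1)

variable [NormedSpace ℝ H]

lemma memLp_clm_apply {B : ℝ → H →L[ℝ] H} {x : ℝ → H} {T : ℝ}
    (hB : MemLp B 2 (volume.restrict (Ioo 0 T))) (hx : ContinuousOn x (Icc 0 T)) :
    MemLp (fun s => B s (x s)) 2 (volume.restrict (Ioo 0 T)) := by
  obtain ⟨C, hC⟩ := isCompact_Icc.exists_bound_of_continuousOn hx
  refine MemLp.of_le_mul (c := C) hB ?_ ?_
  · exact isBoundedBilinearMap_apply.continuous.comp_aestronglyMeasurable
      (hB.1.prodMk (aestronglyMeasurable_Ioo_of_continuousOn hx))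
  · filter_upwards [ae_restrict_mem measurableSet_Ioo] with s hs
    rw [mul_comm]
    exact (B s).le_opNorm_of_le (hC s (Ioo_subset_Icc_self hs))

/-- The right-hand side `N(A(s) - B(s) x)` of the abstract forward problem. -/
def forwardField (N : H → H) (A : ℝ → H) (B : ℝ → H →L[ℝ] H) (s : ℝ) (x : H) : H :=
  N (A s - B s x)

variable {L : ℝ≥0} {N : H → H} {T : ℝ} {A A' : ℝ → H} {B B' : ℝ → H →L[ℝ] H}

lemma norm_forwardField_sub_le (hN : LipschitzWith L N) (s : ℝ) (x y : H) :
    ‖forwardField N A B s x - forwardField N A B s y‖ ≤ L * ‖B s‖ * ‖x - y‖ := by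
  refine (hN.norm_sub_le _ _).trans ?_
  rw [sub_sub_sub_cancel_left, ← map_sub, mul_assoc, norm_sub_rev x y]
  gcongr
  exact (B s).le_opNorm _

lemma integrable_forwardField (hN : LipschitzWith L N)
    (hA : MemLp A 2 (volume.restrict (Ioo 0 T))) (hB : MemLp B 2 (volume.restrict (Ioo 0 T)))
    {x : ℝ → H} (hx : ContinuousOn x (Icc 0 T)) :
    Integrable (fun s => forwardField N A B s (x s)) (volume.restrict (Ioo 0 T)) :=
  (memLp_comp_of_lipschitzWith hN (hA.sub (memLp_clm_apply hB hx))).integrable (by norm_num)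

lemma memLp_kernel (hB : MemLp B 2 (volume.restrict (Ioo 0 T))) :
    MemLp (fun s => L * ‖B s‖) 2 (volume.restrict (Ioo 0 T)) :=
  hB.norm.const_mul (L : ℝ)

lemma exists_forward [CompleteSpace H] (hT : 0 ≤ T) (hN : LipschitzWith L N)
    (hA : MemLp A 2 (volume.restrict (Ioo 0 T))) (hB : MemLp B 2 (volume.restrict (Ioo 0 T)))
    (x₀ : H) : ∃ x, IsIntegralSolution T (forwardField N A B) x₀ x :=
  exists_isIntegralSolution hT x₀ (memLp_kernel hB)
    (ae_of_all _ fun _ _ _ => norm_forwardField_sub_le hN _ _ _)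
    fun _ hx => integrable_forwardField hN hA hB hx

/-- The solution of the abstract forward problem is Lipschitz in the parameters along a line. -/
lemma exists_norm_forward_sub_le (hN : LipschitzWith L N)
    (hA' : MemLp A' 2 (volume.restrict (Ioo 0 T)))
    (hB : MemLp B 2 (volume.restrict (Ioo 0 T))) (hB' : MemLp B' 2 (volume.restrict (Ioo 0 T)))
    {x₀ : H} {f : ℝ → ℝ → H}
    (hf : ∀ ε : ℝ, IsIntegralSolution T
      (forwardField N (fun s => A s + ε • A' s) (fun s => B s + ε • B' s)) x₀ (f ε)) :
    ∃ C : ℝ, 0 ≤ C ∧ ∀ ε : ℝ, |ε| ≤ 1 → ∀ t ∈ Icc 0 T, ‖f ε t - f 0 t‖ ≤ C * |ε| := by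
  -- This kernel dominates the Lipschitz constants of all right-hand sides with `|ε| ≤ 1`, so one
  -- Grönwall constant serves them all.
  have hk : MemLp (fun s => L * (‖B s‖ + ‖B' s‖)) 2 (volume.restrict (Ioo 0 T)) :=
    (hB.norm.add hB'.norm).const_mul (L : ℝ)
  obtain ⟨C, hC0, hC⟩ := exists_gronwall_const hk fun s => by positivity
  have hη : MemLp (fun s => A' s - B' s (f 0 s)) 2 (volume.restrict (Ioo 0 T)) :=
    hA'.sub (memLp_clm_apply hB' (hf 0).continuousOn)
  have hηi : Integrable (fun s => ‖A' s - B' s (f 0 s)‖) (volume.restrict (Ioo 0 T)) :=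
    (hη.integrable (by norm_num)).norm
  set K : ℝ := L * ∫ s in Ioo 0 T, ‖A' s - B' s (f 0 s)‖ with hK
  have hK0 : 0 ≤ K := by positivity
  refine ⟨C * K, by positivity, fun ε hε t ht => ?_⟩
  have hcont : ContinuousOn (fun t => ‖f ε t - f 0 t‖) (Icc 0 T) :=
    ((hf ε).continuousOn.sub (hf 0).continuousOn).norm
  rw [mul_assoc]
  refine hC (K * |ε|) (by positivity) _ hcont (fun t ht => ?_) t ht
  have hki : Integrable (fun s => L * (‖B s‖ + ‖B' s‖) * ‖f ε s - f 0 s‖)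
      (volume.restrict (Ioo 0 T)) :=
    (hk.integrable (by norm_num)).mul_of_top_left (memLp_top_of_continuousOn hcont)
  have hηi' := hηi.const_mul (L * |ε|)
  rw [(hf ε).eq t ht, (hf 0).eq t ht, add_sub_add_left_eq_sub,
    ← intervalIntegral.integral_sub (intervalIntegrable_of_integrable_Ioo (hf ε).integrable ht)
      (intervalIntegrable_of_integrable_Ioo (hf 0).integrable ht)]
  refine (norm_integral_le_of_ae_Ioo (w := fun s => L * |ε| * ‖A' s - B' s (f 0 s)‖
    + L * (‖B s‖ + ‖B' s‖) * ‖f ε s - f 0 s‖) (ae_of_all _ fun s => ?_)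
    (hηi'.add hki) ht).trans ?_
  · refine (hN.norm_sub_le _ _).trans ?_
    -- The source term is evaluated at the unperturbed solution `f 0`, so it is exactly linear in
    -- `ε`; the rest is a multiple of the unknown difference.
    have h1 : A s + ε • A' s - (B s + ε • B' s) (f ε s)
        - (A s + (0 : ℝ) • A' s - (B s + (0 : ℝ) • B' s) (f 0 s))
        = ε • (A' s - B' s (f 0 s)) - (B s + ε • B' s) (f ε s - f 0 s) := by
      simp only [add_apply, smul_apply, map_sub, smul_sub,
        zero_smul, add_zero]
      abel
    have h2 : ‖(B s + ε • B' s) (f ε s - f 0 s)‖ ≤ (‖B s‖ + ‖B' s‖) * ‖f ε s - f 0 s‖ := by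
      refine ContinuousLinearMap.le_of_opNorm_le _ ((norm_add_le _ _).trans ?_) _
      rw [norm_smul]
      gcongr
      exact mul_le_of_le_one_left (norm_nonneg _) hε
    rw [h1]
    calc (L : ℝ) * ‖ε • (A' s - B' s (f 0 s)) - (B s + ε • B' s) (f ε s - f 0 s)‖
        ≤ L * (|ε| * ‖A' s - B' s (f 0 s)‖ + (‖B s‖ + ‖B' s‖) * ‖f ε s - f 0 s‖) := by
          gcongr
          refine (norm_sub_le _ _).trans ?_
          rw [norm_smul, Real.norm_eq_abs]
          gcongr
      _ = _ := by ring
  · have := intervalIntegral.integral_add (intervalIntegrable_of_integrable_Ioo hηi' ht)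
      (intervalIntegrable_of_integrable_Ioo hki ht)
    rw [this, intervalIntegral.integral_const_mul]
    refine add_le_add ?_ le_rfl
    rw [hK, mul_right_comm]
    gcongr
    exact integral_zero_le_integral_Ioo hηi (ae_of_all _ fun _ => norm_nonneg _) ht

/-- The linearized right-hand side. -/
def linearizedField (N' : H → H →L[ℝ] H) (A A' : ℝ → H) (B B' : ℝ → H →L[ℝ] H) (f : ℝ → H)
    (s : ℝ) (x : H) : H :=
  N' (A s - B s (f s)) (A' s - B' s (f s) - B s x)

variable {N' : H → H →L[ℝ] H}

lemma exists_linearized [CompleteSpace H] (hT : 0 ≤ T) (hN : LipschitzWith L N)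
    (hN' : ∀ x h, HasLineDerivAt ℝ N (N' x h) x h)
    (hA : MemLp A 2 (volume.restrict (Ioo 0 T))) (hB : MemLp B 2 (volume.restrict (Ioo 0 T)))
    (hA' : MemLp A' 2 (volume.restrict (Ioo 0 T)))
    (hB' : MemLp B' 2 (volume.restrict (Ioo 0 T)))
    {f : ℝ → H} (hf : ContinuousOn f (Icc 0 T)) (x₀ : H) :
    ∃ g, IsIntegralSolution T (linearizedField N' A A' B B' f) x₀ g := by
  refine exists_isIntegralSolution hT x₀ (memLp_kernel (L := L) hB)
    (ae_of_all _ fun s x y => ?_) fun x hx => ?_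
  · rw [linearizedField, linearizedField, ← map_sub, sub_sub_sub_cancel_left, ← map_sub,
      norm_sub_rev x y, mul_assoc]
    refine (norm_le_of_lipschitzWith_of_hasLineDerivAt hN (hN' _ _)).trans ?_
    gcongr
    exact (B s).le_opNorm _
  · have hξ := hA.sub (memLp_clm_apply hB hf)
    have hη := (hA'.sub (memLp_clm_apply hB' hf)).sub (memLp_clm_apply hB hx)
    refine ((hη.integrable (by norm_num)).norm.const_mul (L : ℝ)).mono'
      (aestronglyMeasurable_of_hasLineDerivAt hN.continuous hξ.1 hη.1
        (ae_of_all _ fun s => hN' _ _)) (ae_of_all _ fun s => ?_)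
    exact norm_le_of_lipschitzWith_of_hasLineDerivAt hN (hN' _ _)

/-- The derivative of the forward solution with respect to the parameters solves the
linearized problem. -/
theorem hasDerivAt_forward (hN : LipschitzWith L N)
    (hN' : ∀ x h, HasLineDerivAt ℝ N (N' x h) x h)
    (hA : MemLp A 2 (volume.restrict (Ioo 0 T))) (hB : MemLp B 2 (volume.restrict (Ioo 0 T)))
    (hA' : MemLp A' 2 (volume.restrict (Ioo 0 T)))
    (hB' : MemLp B' 2 (volume.restrict (Ioo 0 T)))
    {x₀ : H} {f : ℝ → ℝ → H}
    (hf : ∀ ε : ℝ, IsIntegralSolution T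
      (forwardField N (fun s => A s + ε • A' s) (fun s => B s + ε • B' s)) x₀ (f ε))
    {g : ℝ → H} (hg : IsIntegralSolution T (linearizedField N' A A' B B' (f 0)) 0 g)
    {t : ℝ} (ht : t ∈ Icc 0 T) :
    HasDerivAt (fun ε => f ε t) (g t) 0 := by
  obtain ⟨C, hC0, hC⟩ := exists_norm_forward_sub_le hN hA' hB hB' hf
  obtain ⟨D, hD0, hD⟩ := exists_gronwall_const (memLp_kernel (L := L) hB) fun s => by positivity
  have hξ : MemLp (fun s => A s - B s (f 0 s)) 2 (volume.restrict (Ioo 0 T)) :=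
    hA.sub (memLp_clm_apply hB (hf 0).continuousOn)
  have hη : MemLp (fun s => A' s - B' s (f 0 s) - B s (g s)) 2 (volume.restrict (Ioo 0 T)) :=
    (hA'.sub (memLp_clm_apply hB' (hf 0).continuousOn)).sub (memLp_clm_apply hB hg.continuousOn)
  have hηi := hη.integrable (by norm_num)
  have hlit := integral_linearization_error_isLittleO hN hξ.1 hηi (ae_of_all _ fun s => hN' _ _)
  -- Linearization error along the predicted direction `η = A' - B' f - B g`, which does not depend
  -- on `ε`. The true argument of `N` differs from `ξ + ε η` by `-B (f_ε - f - ε g) - ε B' (f_ε -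
  -- f)`, which needs only the Lipschitz bound.
  set ρ : ℝ → ℝ → ℝ := fun ε s => ‖N (A s - B s (f 0 s) + ε • (A' s - B' s (f 0 s) - B s (g s)))
    - N (A s - B s (f 0 s)) - ε • N' (A s - B s (f 0 s)) (A' s - B' s (f 0 s) - B s (g s))‖ with hρ
  have hρi : ∀ ε, Integrable (ρ ε) (volume.restrict (Ioo 0 T)) := fun ε => by
    have h1 := (memLp_comp_of_lipschitzWith hN (hξ.add (hη.const_smul ε))).integrable
      (by norm_num)
    have h2 := (memLp_comp_of_lipschitzWith hN hξ).integrable (by norm_num)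
    exact ((h1.sub h2).sub (hg.integrable.smul ε)).norm
  have hBi' : Integrable (fun s => ‖B' s‖) (volume.restrict (Ioo 0 T)) :=
    (hB'.integrable (by norm_num)).norm
  set K : ℝ := ∫ s in Ioo 0 T, ‖B' s‖ with hK
  have hK0 : 0 ≤ K := by positivity
  -- The quadratic term is `ε B' (f_ε - f)`, estimated with the a priori bound `C |ε|`; the term
  -- with `B` is the one fed to Grönwall.
  have key : ∀ ε : ℝ, |ε| ≤ 1 → ∀ t ∈ Icc 0 T, ‖f ε t - f 0 t - ε • g t‖
      ≤ D * (L * (C * |ε| * |ε|) * K + ∫ s in Ioo 0 T, ρ ε s) := by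
    intro ε hε t ht
    have hcont : ContinuousOn (fun t => ‖f ε t - f 0 t - ε • g t‖) (Icc 0 T) :=
      (((hf ε).continuousOn.sub (hf 0).continuousOn).sub (hg.continuousOn.const_smul ε)).norm
    have hρ0 : 0 ≤ ∫ s in Ioo 0 T, ρ ε s := integral_nonneg fun s => norm_nonneg _
    refine hD _ (by positivity) _ hcont (fun t ht => ?_) t ht
    have hki : Integrable (fun s => L * ‖B s‖ * ‖f ε s - f 0 s - ε • g s‖)
        (volume.restrict (Ioo 0 T)) :=
      ((memLp_kernel (L := L) hB).integrable (by norm_num)).mul_of_top_left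
        (memLp_top_of_continuousOn hcont)
    have hBi'' := hBi'.const_mul (L * (C * |ε| * |ε|))
    have j0 := intervalIntegrable_of_integrable_Ioo (hf 0).integrable ht
    have jε := intervalIntegrable_of_integrable_Ioo (hf ε).integrable ht
    have jg := intervalIntegrable_of_integrable_Ioo hg.integrable ht
    have jgs : IntervalIntegrable (fun s => ε • linearizedField N' A A' B B' (f 0) s (g s))
      volume 0 t := jg.smul ε
    have e1 : f ε t - f 0 t - ε • g t = ∫ s in 0..t,
        (forwardField N (fun s => A s + ε • A' s) (fun s => B s + ε • B' s) s (f ε s)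
          - forwardField N (fun s => A s + (0 : ℝ) • A' s) (fun s => B s + (0 : ℝ) • B' s) s (f 0 s)
          - ε • linearizedField N' A A' B B' (f 0) s (g s)) := by
      rw [intervalIntegral.integral_sub (jε.sub j0) jgs,
        intervalIntegral.integral_sub jε j0, intervalIntegral.integral_smul]
      rw [(hf ε).eq t ht, (hf 0).eq t ht, hg.eq t ht, add_sub_add_left_eq_sub, zero_add]
    rw [e1]
    refine (norm_integral_le_of_ae_Ioo (w := fun s => L * (C * |ε| * |ε|) * ‖B' s‖ + ρ ε s
      + L * ‖B s‖ * ‖f ε s - f 0 s - ε • g s‖) ?_ ((hBi''.add (hρi ε)).add hki) ht).trans ?_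
    · filter_upwards [ae_restrict_mem measurableSet_Ioo] with s hs
      have h1 : forwardField N (fun s => A s + ε • A' s) (fun s => B s + ε • B' s) s (f ε s)
          - forwardField N (fun s => A s + (0 : ℝ) • A' s) (fun s => B s + (0 : ℝ) • B' s) s (f 0 s)
          - ε • linearizedField N' A A' B B' (f 0) s (g s)
          = (N (A s + ε • A' s - (B s + ε • B' s) (f ε s))
              - N (A s - B s (f 0 s) + ε • (A' s - B' s (f 0 s) - B s (g s))))
            + (N (A s - B s (f 0 s) + ε • (A' s - B' s (f 0 s) - B s (g s)))
              - N (A s - B s (f 0 s))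
              - ε • N' (A s - B s (f 0 s)) (A' s - B' s (f 0 s) - B s (g s))) := by
        simp only [forwardField, linearizedField, zero_smul, add_zero]
        abel
      have h2 : A s + ε • A' s - (B s + ε • B' s) (f ε s)
          - (A s - B s (f 0 s) + ε • (A' s - B' s (f 0 s) - B s (g s)))
          = -(B s (f ε s - f 0 s - ε • g s)) - ε • B' s (f ε s - f 0 s) := by
        simp only [add_apply, smul_apply, map_sub, smul_sub,
          map_smul]
        abel
      have h3 : ‖ε • B' s (f ε s - f 0 s)‖ ≤ C * |ε| * |ε| * ‖B' s‖ := by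
        rw [norm_smul, Real.norm_eq_abs]
        calc |ε| * ‖B' s (f ε s - f 0 s)‖ ≤ |ε| * (‖B' s‖ * (C * |ε|)) := by
              gcongr
              exact (B' s).le_opNorm_of_le (hC ε hε s (Ioo_subset_Icc_self hs))
          _ = _ := by ring
      have h4 : ‖N (A s + ε • A' s - (B s + ε • B' s) (f ε s))
              - N (A s - B s (f 0 s) + ε • (A' s - B' s (f 0 s) - B s (g s)))‖
          ≤ L * (‖B s‖ * ‖f ε s - f 0 s - ε • g s‖ + C * |ε| * |ε| * ‖B' s‖) := by
        refine (hN.norm_sub_le _ _).trans ?_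
        rw [h2]
        gcongr
        refine (norm_sub_le _ _).trans ?_
        rw [norm_neg]
        gcongr
        exact (B s).le_opNorm _
      rw [h1]
      refine (norm_add_le _ _).trans ((add_le_add h4 le_rfl).trans (le_of_eq ?_))
      simp only [hρ]
      ring
    · have a1 := intervalIntegral.integral_add
        ((intervalIntegrable_of_integrable_Ioo hBi'' ht).add
          (intervalIntegrable_of_integrable_Ioo (hρi ε) ht))
        (intervalIntegrable_of_integrable_Ioo hki ht)
      rw [a1, intervalIntegral.integral_add (intervalIntegrable_of_integrable_Ioo hBi'' ht)
          (intervalIntegrable_of_integrable_Ioo (hρi ε) ht), intervalIntegral.integral_const_mul]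
      gcongr
      · exact integral_zero_le_integral_Ioo hBi' (ae_of_all _ fun _ => norm_nonneg _) ht
      · exact integral_zero_le_integral_Ioo (hρi ε) (ae_of_all _ fun _ => norm_nonneg _) ht
  rw [hasDerivAt_iff_isLittleO_nhds_zero]
  simp only [zero_add]
  have hsq : (fun ε : ℝ => L * (C * |ε| * |ε|) * K) =o[𝓝 0] fun ε : ℝ => ε := by
    have h1 : (fun ε : ℝ => ε ^ 2) =o[𝓝 0] fun ε : ℝ => ε := by
      simpa using Asymptotics.isLittleO_pow_pow (𝕜 := ℝ) (m := 1) (n := 2) (by norm_num)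
    refine (h1.const_mul_left (L * C * K)).congr_left fun ε => ?_
    rw [mul_assoc C, abs_mul_abs_self]; ring
  refine Asymptotics.IsBigO.trans_isLittleO (Asymptotics.IsBigO.of_bound 1 ?_)
    ((hsq.add hlit).const_mul_left D)
  have hev : ∀ᶠ ε : ℝ in 𝓝 0, |ε| ≤ 1 := by
    filter_upwards [Metric.ball_mem_nhds (0 : ℝ) one_pos] with ε hε
    rw [Metric.mem_ball, Real.dist_eq, sub_zero] at hε
    exact hε.le
  filter_upwards [hev] with ε hε
  rw [one_mul]
  exact (key ε hε t ht).trans (le_abs_self _)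

end Sensitivity

end DeepIDE

end

noncomputable section

namespace DeepIDE

open Filter Topology
open scoped NNReal ENNReal RealInnerProductSpace

/-! ### Pairings and Nemytskii operators on `L²`. -/

section L2

variable {α β : Type*} [MeasurableSpace α] [MeasurableSpace β] {μ : Measure α} {ν : Measure β}

lemma L2_norm_sq_eq_integral (f : Lp ℝ 2 μ) : ‖f‖ ^ 2 = ∫ a, f a ^ 2 ∂μ := by
  rw [← real_inner_self_eq_norm_sq, L2.inner_def]
  simp [pow_two]

lemma L2_inner_eq_integral (f g : Lp ℝ 2 μ) : ⟪f, g⟫ = ∫ a, f a * g a ∂μ := by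
  rw [L2.inner_def]
  simp [mul_comm]

lemma L2_integrable_mul (f g : Lp ℝ 2 μ) : Integrable (fun a => f a * g a) μ :=
  (Lp.memLp f).integrable_mul (Lp.memLp g)

lemma L2_integrable_sq (f : Lp ℝ 2 μ) : Integrable (fun a => f a ^ 2) μ :=
  (Lp.memLp f).integrable_sq

/-- The Nemytskii operator `x ↦ σ ∘ x` on `L²`. -/
def nemytskii (μ : Measure α) [IsFiniteMeasure μ] {L : ℝ≥0} {σ : ℝ → ℝ} (hσ : LipschitzWith L σ)
    (x : Lp ℝ 2 μ) : Lp ℝ 2 μ :=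
  (memLp_comp_of_lipschitzWith hσ (Lp.memLp x)).toLp _

section Nemytskii

variable {L : ℝ≥0} {σ : ℝ → ℝ}

/-- The derivative of a real function is always Borel measurable, and here it is bounded by `L`; its
continuity plays no role. -/
lemma memLp_deriv_comp_mul (hσ : LipschitzWith L σ) (x h : Lp ℝ 2 μ) : MemLp (fun a => deriv σ (x a) * h a) 2 μ := by
  refine MemLp.of_le_mul (c := L) (Lp.memLp h) ?_ (ae_of_all _ fun a => ?_)
  · exact ((measurable_deriv σ).comp_aemeasurable
      (Lp.aestronglyMeasurable x).aemeasurable).aestronglyMeasurable.mul (Lp.aestronglyMeasurable h)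
  · rw [norm_mul]
    gcongr
    exact norm_deriv_le_of_lipschitz hσ

/-- The Gateaux derivative of the Nemytskii operator: multiplication by `σ' ∘ x`. -/
def nemytskiiDeriv (hσ : LipschitzWith L σ) (x : Lp ℝ 2 μ) : Lp ℝ 2 μ →L[ℝ] Lp ℝ 2 μ :=
  LinearMap.mkContinuous
    { toFun := fun h => (memLp_deriv_comp_mul hσ x h).toLp _
      map_add' := fun g h => by
        rw [← MemLp.toLp_add]
        refine MemLp.toLp_congr _ _ ?_
        filter_upwards [Lp.coeFn_add g h] with a ha
        simp only [ha, Pi.add_apply, mul_add]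
      map_smul' := fun c h => by
        rw [RingHom.id_apply, ← MemLp.toLp_const_smul]
        refine MemLp.toLp_congr _ _ ?_
        filter_upwards [Lp.coeFn_smul c h] with a ha
        simp only [ha, Pi.smul_apply, smul_eq_mul, mul_left_comm] } L
    (fun h => by
      refine Lp.norm_le_mul_norm_of_ae_le_mul ?_
      filter_upwards [(memLp_deriv_comp_mul hσ x h).coeFn_toLp] with a ha
      simp only [LinearMap.coe_mk, AddHom.coe_mk]
      rw [ha, norm_mul]
      gcongr
      exact norm_deriv_le_of_lipschitz hσ)

lemma coeFn_nemytskiiDeriv (hσ : LipschitzWith L σ) (x h : Lp ℝ 2 μ) :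
    nemytskiiDeriv hσ x h =ᵐ[μ] fun a => deriv σ (x a) * h a :=
  (memLp_deriv_comp_mul hσ x h).coeFn_toLp

lemma inner_nemytskiiDeriv_left (hσ : LipschitzWith L σ) (x g h : Lp ℝ 2 μ) :
    ⟪nemytskiiDeriv hσ x g, h⟫ = ⟪g, nemytskiiDeriv hσ x h⟫ := by
  rw [L2_inner_eq_integral, L2_inner_eq_integral]
  refine integral_congr_ae ?_
  filter_upwards [coeFn_nemytskiiDeriv hσ x g, coeFn_nemytskiiDeriv hσ x h] with a h1 h2
  rw [h1, h2]; ring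

variable [IsFiniteMeasure μ]

lemma coeFn_nemytskii (hσ : LipschitzWith L σ) (x : Lp ℝ 2 μ) : nemytskii μ hσ x =ᵐ[μ] fun a => σ (x a) :=
  MemLp.coeFn_toLp _

lemma lipschitzWith_nemytskii (hσ : LipschitzWith L σ) : LipschitzWith L (nemytskii μ hσ) := by
  refine LipschitzWith.of_dist_le_mul fun x y => ?_
  rw [dist_eq_norm, dist_eq_norm]
  refine Lp.norm_le_mul_norm_of_ae_le_mul ?_
  filter_upwards [coeFn_nemytskii hσ x, coeFn_nemytskii hσ y,
    Lp.coeFn_sub (nemytskii μ hσ x) (nemytskii μ hσ y), Lp.coeFn_sub x y] with a h1 h2 h3 h4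
  rw [h3, h4, Pi.sub_apply, Pi.sub_apply, h1, h2]
  exact hσ.norm_sub_le _ _

/-- The Nemytskii operator of a differentiable Lipschitz function is Gateaux differentiable. -/
lemma hasLineDerivAt_nemytskii (hσ : LipschitzWith L σ) (hσd : Differentiable ℝ σ) (x h : Lp ℝ 2 μ) :
    HasLineDerivAt ℝ (nemytskii μ hσ) (nemytskiiDeriv hσ x h) x h := by
  refine hasDerivAt_iff_isLittleO_nhds_zero.2 ?_
  simp only [zero_add, zero_smul, add_zero]
  have hE : ∀ ε : ℝ, nemytskii μ hσ (x + ε • h) - nemytskii μ hσ x - ε • nemytskiiDeriv hσ x h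
      =ᵐ[μ] fun a => σ (x a + ε * h a) - σ (x a) - ε * (deriv σ (x a) * h a) := by
    intro ε
    filter_upwards [Lp.coeFn_sub (nemytskii μ hσ (x + ε • h) - nemytskii μ hσ x)
        (ε • nemytskiiDeriv hσ x h), Lp.coeFn_sub (nemytskii μ hσ (x + ε • h)) (nemytskii μ hσ x),
      Lp.coeFn_smul ε (nemytskiiDeriv hσ x h), coeFn_nemytskii hσ (x + ε • h),
      coeFn_nemytskii hσ x, coeFn_nemytskiiDeriv hσ x h, Lp.coeFn_add x (ε • h),
      Lp.coeFn_smul ε h] with a h1 h2 h3 h4 h5 h6 h7 h8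
    simp only [h1, h2, h3, h4, h5, h6, h7, h8, Pi.sub_apply, Pi.add_apply, Pi.smul_apply,
      smul_eq_mul]
  -- The squared `L²` norm of the error quotient is the integral of a pointwise quotient that tends
  -- to 0 and is dominated by `(2 L h)²`. The fixed direction `h` is what makes domination possible.
  have hsq : ∀ ε : ℝ,
      (‖nemytskii μ hσ (x + ε • h) - nemytskii μ hσ x - ε • nemytskiiDeriv hσ x h‖ / ε) ^ 2
      = ∫ a, ((σ (x a + ε * h a) - σ (x a) - ε * (deriv σ (x a) * h a)) / ε) ^ 2 ∂μ := by
    intro ε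
    rw [div_pow, L2_norm_sq_eq_integral, ← integral_div]
    refine integral_congr_ae ?_
    filter_upwards [hE ε] with a ha
    rw [ha, div_pow]
  have hmeas : ∀ ε : ℝ, AEStronglyMeasurable
      (fun a => σ (x a + ε * h a) - σ (x a) - ε * (deriv σ (x a) * h a)) μ := fun ε =>
    (Lp.aestronglyMeasurable _).congr (hE ε)
  have hlim : Tendsto (fun ε : ℝ =>
      ∫ a, ((σ (x a + ε * h a) - σ (x a) - ε * (deriv σ (x a) * h a)) / ε) ^ 2 ∂μ) (𝓝 0)
      (𝓝 (∫ _, (0 : ℝ) ∂μ)) := by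
    refine tendsto_integral_filter_of_dominated_convergence (fun a => (2 * L) ^ 2 * h a ^ 2)
      (Eventually.of_forall fun ε => ?_) (Eventually.of_forall fun ε => ae_of_all _ fun a => ?_)
      ((L2_integrable_sq h).const_mul _) (ae_of_all _ fun a => ?_)
    · simp_rw [div_eq_mul_inv]
      exact ((hmeas ε).mul_const _).pow 2
    · rw [Real.norm_of_nonneg (sq_nonneg _), ← mul_pow, sq_le_sq, abs_div]
      refine div_le_of_le_mul₀ (abs_nonneg _) (abs_nonneg _) ?_
      have h1 := hσ.norm_sub_le (x a + ε * h a) (x a)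
      have h2 : ‖deriv σ (x a)‖ ≤ L := norm_deriv_le_of_lipschitz hσ
      rw [add_sub_cancel_left] at h1
      simp only [Real.norm_eq_abs] at h1 h2
      have hL : |(L : ℝ)| = L := abs_of_nonneg L.2
      calc |σ (x a + ε * h a) - σ (x a) - ε * (deriv σ (x a) * h a)|
          ≤ |σ (x a + ε * h a) - σ (x a)| + |ε * (deriv σ (x a) * h a)| := abs_sub _ _
        _ ≤ L * |ε * h a| + |ε| * (L * |h a|) := by
            rw [abs_mul ε (deriv σ (x a) * h a), abs_mul (deriv σ (x a))]
            gcongr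
        _ = _ := by rw [abs_mul, abs_mul, abs_mul, abs_two, hL]; ring
    · have h1 : HasDerivAt (fun ε : ℝ => σ (x a + ε * h a)) (deriv σ (x a) * h a) 0 := by
        have h3 : HasDerivAt (fun ε : ℝ => x a + ε * h a) (h a) 0 := by
          simpa using ((hasDerivAt_id (0 : ℝ)).mul_const (h a)).const_add (x a)
        have h4 : HasDerivAt σ (deriv σ (x a)) (x a + 0 * h a) := by
          simpa using (hσd (x a)).hasDerivAt
        exact h4.comp (0 : ℝ) h3
      have h2 := (hasDerivAt_iff_isLittleO_nhds_zero.1 h1).tendsto_div_nhds_zero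
      simp only [zero_add, zero_mul, add_zero, smul_eq_mul] at h2
      simpa using h2.pow 2
  rw [← Asymptotics.isLittleO_norm_left, Asymptotics.isLittleO_iff_tendsto (by rintro ε rfl; simp)]
  simp_rw [← hsq] at hlim
  rw [integral_zero] at hlim
  rw [tendsto_zero_iff_abs_tendsto_zero]
  have := hlim.sqrt
  rw [Real.sqrt_zero] at this
  refine this.congr fun ε => ?_
  rw [Real.sqrt_sq_eq_abs]
  rfl

end Nemytskii

/-! ### Hilbert–Schmidt operators, rank-one kernels and adjoints. -/

section Tensor

lemma memLp_tensor (p : Lp ℝ 2 μ) (q : Lp ℝ 2 ν) :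
    MemLp (fun z : α × β => p z.1 * q z.2) 2 (μ.prod ν) := by
  refine (memLp_two_iff_integrable_sq
    (((Lp.aestronglyMeasurable p).comp_fst).mul ((Lp.aestronglyMeasurable q).comp_snd))).2 ?_
  simp_rw [Pi.mul_apply, mul_pow]
  exact (L2_integrable_sq p).mul_prod (L2_integrable_sq q)

variable [SFinite ν]

lemma aestronglyMeasurable_kernel_integral (b : Lp ℝ 2 (μ.prod ν)) (q : Lp ℝ 2 ν) :
    AEStronglyMeasurable (fun y => ∫ z, b (y, z) * q z ∂ν) μ :=
  (((Lp.stronglyMeasurable b).mul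
    ((Lp.stronglyMeasurable q).comp_measurable measurable_snd)).integral_prod_right'
    (ν := ν)).aestronglyMeasurable

lemma integrable_integral_sq (b : Lp ℝ 2 (μ.prod ν)) :
    Integrable (fun y => ∫ z, b (y, z) ^ 2 ∂ν) μ :=
  (L2_integrable_sq b).integral_prod_left

variable [SFinite μ]

lemma ae_memLp_prodMk_left (b : Lp ℝ 2 (μ.prod ν)) :
    ∀ᵐ y ∂μ, MemLp (fun z => b (y, z)) 2 ν := by
  filter_upwards [(L2_integrable_sq b).prod_right_ae] with y hy
  exact (memLp_two_iff_integrable_sq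
    ((Lp.stronglyMeasurable b).comp_measurable measurable_prodMk_left).aestronglyMeasurable).2 hy

lemma ae_memLp_prodMk_right (b : Lp ℝ 2 (μ.prod ν)) :
    ∀ᵐ z ∂ν, MemLp (fun y => b (y, z)) 2 μ := by
  filter_upwards [(L2_integrable_sq b).prod_left_ae] with y hy
  exact (memLp_two_iff_integrable_sq
    ((Lp.stronglyMeasurable b).comp_measurable measurable_prodMk_right).aestronglyMeasurable).2 hy

/-- Cauchy–Schwarz on almost every section; integrating in `y` gives the Hilbert–Schmidt bound `‖K_b
q‖ ≤ ‖b‖ ‖q‖`. -/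
lemma ae_sq_kernel_integral_le (b : Lp ℝ 2 (μ.prod ν)) (q : Lp ℝ 2 ν) :
    ∀ᵐ y ∂μ, (∫ z, b (y, z) * q z ∂ν) ^ 2 ≤ ‖q‖ ^ 2 * ∫ z, b (y, z) ^ 2 ∂ν := by
  filter_upwards [ae_memLp_prodMk_left b] with y hy
  have h1 : ∫ z, b (y, z) * q z ∂ν = ⟪hy.toLp _, q⟫ := by
    rw [L2_inner_eq_integral]
    refine integral_congr_ae ?_
    filter_upwards [hy.coeFn_toLp] with z hz
    rw [hz]
  have h2 : ∫ z, b (y, z) ^ 2 ∂ν = ‖hy.toLp _‖ ^ 2 := by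
    rw [L2_norm_sq_eq_integral]
    refine integral_congr_ae ?_
    filter_upwards [hy.coeFn_toLp] with z hz
    rw [hz]
  rw [h1, h2, ← mul_pow, sq_le_sq, abs_of_nonneg (by positivity : 0 ≤ ‖q‖ * _), mul_comm]
  exact abs_real_inner_le_norm _ _

lemma memLp_kernel_integral (b : Lp ℝ 2 (μ.prod ν)) (q : Lp ℝ 2 ν) :
    MemLp (fun y => ∫ z, b (y, z) * q z ∂ν) 2 μ := by
  rw [memLp_two_iff_integrable_sq (aestronglyMeasurable_kernel_integral b q)]
  refine ((integrable_integral_sq b).const_mul (‖q‖ ^ 2)).mono'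
    ((aestronglyMeasurable_kernel_integral b q).pow 2) ?_
  filter_upwards [ae_sq_kernel_integral_le b q] with y hy
  rwa [Real.norm_of_nonneg (sq_nonneg _)]

lemma ae_integrable_kernel_mul (b : Lp ℝ 2 (μ.prod ν)) (q : Lp ℝ 2 ν) :
    ∀ᵐ y ∂μ, Integrable (fun z => b (y, z) * q z) ν := by
  filter_upwards [ae_memLp_prodMk_left b] with y hy using hy.integrable_mul (Lp.memLp q)

/-- The Hilbert–Schmidt operator `(q ↦ ∫ b(·, z) q(z) dz)` with kernel `b ∈ L²`. -/
def kernelOp : Lp ℝ 2 (μ.prod ν) →L[ℝ] Lp ℝ 2 ν →L[ℝ] Lp ℝ 2 μ :=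
  LinearMap.mkContinuous₂
    (LinearMap.mk₂ ℝ (fun b q => (memLp_kernel_integral b q).toLp _)
      (fun b b' q => by
        rw [← MemLp.toLp_add]
        refine MemLp.toLp_congr _ _ ?_
        filter_upwards [ae_integrable_kernel_mul b q, ae_integrable_kernel_mul b' q,
          Measure.ae_ae_of_ae_prod (Lp.coeFn_add b b')] with y h1 h2 h3
        rw [Pi.add_apply, ← integral_add h1 h2]
        refine integral_congr_ae ?_
        filter_upwards [h3] with z hz
        rw [hz, Pi.add_apply, add_mul])
      (fun c b q => by
        rw [← MemLp.toLp_const_smul]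
        refine MemLp.toLp_congr _ _ ?_
        filter_upwards [Measure.ae_ae_of_ae_prod (Lp.coeFn_smul c b)] with y h3
        rw [Pi.smul_apply, smul_eq_mul, ← integral_const_mul]
        refine integral_congr_ae ?_
        filter_upwards [h3] with z hz
        rw [hz, Pi.smul_apply, smul_eq_mul, mul_assoc])
      (fun b q q' => by
        rw [← MemLp.toLp_add]
        refine MemLp.toLp_congr _ _ ?_
        filter_upwards [ae_integrable_kernel_mul b q, ae_integrable_kernel_mul b q'] with y h1 h2
        rw [Pi.add_apply, ← integral_add h1 h2]
        refine integral_congr_ae ?_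
        filter_upwards [Lp.coeFn_add q q'] with z hz
        rw [hz, Pi.add_apply, mul_add])
      (fun c b q => by
        rw [← MemLp.toLp_const_smul]
        refine MemLp.toLp_congr _ _ (ae_of_all _ fun y => ?_)
        simp only [Pi.smul_apply, smul_eq_mul]
        rw [← integral_const_mul]
        refine integral_congr_ae ?_
        filter_upwards [Lp.coeFn_smul c q] with z hz
        rw [hz, Pi.smul_apply, smul_eq_mul, mul_left_comm])) 1
    (fun b q => by
      rw [one_mul, LinearMap.mk₂_apply]
      refine (sq_le_sq₀ (norm_nonneg _) (by positivity)).1 ?_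
      rw [L2_norm_sq_eq_integral, mul_pow, L2_norm_sq_eq_integral b,
        integral_prod _ (L2_integrable_sq b), mul_comm, ← integral_const_mul]
      refine integral_mono_ae (MemLp.integrable_sq (Lp.memLp _))
        ((integrable_integral_sq b).const_mul _) ?_
      filter_upwards [(memLp_kernel_integral b q).coeFn_toLp, ae_sq_kernel_integral_le b q]
        with y h1 h2
      rwa [h1])

lemma coeFn_kernelOp (b : Lp ℝ 2 (μ.prod ν)) (q : Lp ℝ 2 ν) :
    kernelOp b q =ᵐ[μ] fun y => ∫ z, b (y, z) * q z ∂ν :=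
  (memLp_kernel_integral b q).coeFn_toLp

/-- The pairing of a kernel with `p ⊗ q` is `⟨p, K q⟩`. -/
lemma integral_prod_tensor_mul (p : Lp ℝ 2 μ) (q : Lp ℝ 2 ν) (b : Lp ℝ 2 (μ.prod ν)) :
    ∫ z : α × β, p z.1 * q z.2 * b z ∂μ.prod ν = ⟪p, kernelOp b q⟫ := by
  have hi : Integrable (fun z : α × β => p z.1 * q z.2 * b z) (μ.prod ν) :=
    (memLp_tensor p q).integrable_mul (Lp.memLp b)
  rw [integral_prod _ hi, L2_inner_eq_integral]
  refine integral_congr_ae ?_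
  filter_upwards [coeFn_kernelOp b q] with y hy
  rw [hy, ← integral_const_mul]
  congr 1; ext z; ring

/-- The tensor product `(p ⊗ q)(y, z) = p(y) q(z)`. -/
def tensor : Lp ℝ 2 μ →L[ℝ] Lp ℝ 2 ν →L[ℝ] Lp ℝ 2 (μ.prod ν) :=
  LinearMap.mkContinuous₂
    (LinearMap.mk₂ ℝ (fun p q => (memLp_tensor p q).toLp _)
      (fun p p' q => by
        rw [← MemLp.toLp_add]
        refine MemLp.toLp_congr _ _ ?_
        filter_upwards [Measure.quasiMeasurePreserving_fst.ae (Lp.coeFn_add p p')] with z hz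
        rw [hz, Pi.add_apply, Pi.add_apply, add_mul])
      (fun c p q => by
        rw [← MemLp.toLp_const_smul]
        refine MemLp.toLp_congr _ _ ?_
        filter_upwards [Measure.quasiMeasurePreserving_fst.ae (Lp.coeFn_smul c p)] with z hz
        rw [hz, Pi.smul_apply, Pi.smul_apply, smul_mul_assoc])
      (fun p q q' => by
        rw [← MemLp.toLp_add]
        refine MemLp.toLp_congr _ _ ?_
        filter_upwards [Measure.quasiMeasurePreserving_snd.ae (Lp.coeFn_add q q')] with z hz
        rw [hz, Pi.add_apply, Pi.add_apply, mul_add])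
      (fun c p q => by
        rw [← MemLp.toLp_const_smul]
        refine MemLp.toLp_congr _ _ ?_
        filter_upwards [Measure.quasiMeasurePreserving_snd.ae (Lp.coeFn_smul c q)] with z hz
        rw [hz, Pi.smul_apply, Pi.smul_apply, mul_smul_comm])) 1
    (fun p q => by
      rw [one_mul, LinearMap.mk₂_apply]
      refine (sq_le_sq₀ (norm_nonneg _) (by positivity)).1 (le_of_eq ?_)
      rw [L2_norm_sq_eq_integral, mul_pow, L2_norm_sq_eq_integral p, L2_norm_sq_eq_integral q,
        ← integral_prod_mul]
      refine integral_congr_ae ?_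
      filter_upwards [(memLp_tensor p q).coeFn_toLp] with z hz
      rw [hz, mul_pow])

lemma coeFn_tensor (p : Lp ℝ 2 μ) (q : Lp ℝ 2 ν) :
    tensor p q =ᵐ[μ.prod ν] fun z => p z.1 * q z.2 :=
  (memLp_tensor p q).coeFn_toLp

/-- Turns the derivative in the direction of a kernel into a pairing with a rank-one gradient; this
is the source of the product form of both weight gradients. -/
lemma inner_tensor_left (p : Lp ℝ 2 μ) (q : Lp ℝ 2 ν) (b : Lp ℝ 2 (μ.prod ν)) :
    ⟪tensor p q, b⟫ = ⟪p, kernelOp b q⟫ := by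
  rw [← integral_prod_tensor_mul, L2_inner_eq_integral]
  refine integral_congr_ae ?_
  filter_upwards [coeFn_tensor p q] with z hz
  rw [hz]

/-- The adjoint of a Hilbert–Schmidt operator integrates the kernel in its first variable. -/
lemma coeFn_adjoint_kernelOp (b : Lp ℝ 2 (μ.prod ν)) (p : Lp ℝ 2 μ) :
    ContinuousLinearMap.adjoint (kernelOp b) p =ᵐ[ν] fun z => ∫ y, b (y, z) * p y ∂μ := by
  have hsw : MeasurePreserving (Prod.swap : β × α → α × β) (ν.prod μ) (μ.prod ν) :=
    Measure.measurePreserving_swap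
  set b' : Lp ℝ 2 (ν.prod μ) := Lp.compMeasurePreserving Prod.swap hsw b with hb'
  have hb'c : b' =ᵐ[ν.prod μ] fun z => b z.swap := Lp.coeFn_compMeasurePreserving b hsw
  -- Testing against `q`, both sides equal the integral of `p ⊗ q` against `b`, up to swapping the
  -- variables.
  have h1 : ContinuousLinearMap.adjoint (kernelOp b) p = kernelOp b' p := by
    refine ext_inner_left ℝ fun q => ?_
    rw [ContinuousLinearMap.adjoint_inner_right, real_inner_comm, ← integral_prod_tensor_mul,
      ← integral_prod_tensor_mul, ← integral_prod_swap]
    refine integral_congr_ae ?_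
    filter_upwards [hb'c] with z hz
    rw [hz, Prod.fst_swap, Prod.snd_swap, mul_comm (q z.1)]
  rw [h1]
  filter_upwards [coeFn_kernelOp b' p, Measure.ae_ae_of_ae_prod hb'c] with z h2 h3
  rw [h2]
  refine integral_congr_ae ?_
  filter_upwards [h3] with y hy
  rw [hy, Prod.swap_prod_mk]

end Tensor

/-! ### Identification of `L²(μ × ν)` with `L²(ν; L²(μ))`. -/

section Curry

open Classical in
/-- The section `u(·, s) ∈ L²(μ)` of `u ∈ L²(μ × ν)`. -/
def curryLp (u : Lp ℝ 2 (μ.prod ν)) (s : β) : Lp ℝ 2 μ :=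
  if h : MemLp (fun y => u (y, s)) 2 μ then h.toLp _ else 0

/-- Balls form a basis, which generates the Borel σ-algebra by second countability, and preimages of
balls are sublevel sets of distance functions. -/
lemma measurable_of_measurable_edist {E : Type*} [PseudoEMetricSpace E]
    [SecondCountableTopology E] [MeasurableSpace E] [BorelSpace E] {c : β → E}
    (h : ∀ g, Measurable fun s => edist (c s) g) : Measurable c := by
  have hB : TopologicalSpace.IsTopologicalBasis
      {t : Set E | ∃ (x : E) (r : ℝ≥0∞), t = {y | edist y x < r}} := by
    refine TopologicalSpace.isTopologicalBasis_of_isOpen_of_nhds ?_ ?_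
    · rintro _ ⟨x, r, rfl⟩
      exact Metric.isOpen_eball
    · intro x u hx hu
      obtain ⟨r, hr, hru⟩ := EMetric.isOpen_iff.1 hu x hx
      exact ⟨_, ⟨x, r, rfl⟩, by simpa using hr, hru⟩
  rw [BorelSpace.measurable_eq (α := E), hB.borel_eq_generateFrom]
  refine measurable_generateFrom ?_
  rintro _ ⟨x, r, rfl⟩
  exact measurableSet_lt (h x) measurable_const

/-- `L²(μ)` is separable because the σ-algebra is countably generated, so it suffices that each
distance `‖u(·, s) - g‖` is measurable in `s`; this is Tonelli. -/
lemma aestronglyMeasurable_curryLp [SFinite μ]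
    [MeasurableSpace.CountablyGenerated α] (u : Lp ℝ 2 (μ.prod ν)) :
    AEStronglyMeasurable (curryLp u) ν := by
  borelize ↥(Lp ℝ 2 μ)
  have : Fact ((2 : ℝ≥0∞) ≠ ∞) := ⟨by norm_num⟩
  have hsep : SecondCountableTopology (Lp ℝ 2 μ) := inferInstance
  have hm : ∀ g : Lp ℝ 2 μ, Measurable fun s => eLpNorm (fun y => u (y, s) - g y) 2 μ := by
    intro g
    simp_rw [eLpNorm_eq_lintegral_rpow_enorm_toReal (p := 2) (by norm_num) (by norm_num)]
    refine Measurable.pow_const ?_ _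
    refine Measurable.lintegral_prod_left' (f := fun z : α × β =>
      ‖u z - g z.1‖ₑ ^ (2 : ℝ≥0∞).toReal) ?_
    refine Measurable.pow_const ?_ _
    exact ((Lp.stronglyMeasurable u).sub
      ((Lp.stronglyMeasurable g).comp_measurable measurable_fst)).measurable.enorm
  have hm0 : Measurable fun s => eLpNorm (fun y => u (y, s)) 2 μ := by
    simp_rw [eLpNorm_eq_lintegral_rpow_enorm_toReal (p := 2) (by norm_num) (by norm_num)]
    refine Measurable.pow_const ?_ _
    refine Measurable.lintegral_prod_left' (f := fun z : α × β =>
      ‖u z‖ₑ ^ (2 : ℝ≥0∞).toReal) ?_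
    exact (Lp.stronglyMeasurable u).measurable.enorm.pow_const _
  refine (measurable_of_measurable_edist fun g => ?_).aestronglyMeasurable
  have hset : MeasurableSet {s | MemLp (fun y => u (y, s)) 2 μ} := by
    have : {s | MemLp (fun y => u (y, s)) 2 μ} = {s | eLpNorm (fun y => u (y, s)) 2 μ < ∞} := by
      ext s
      exact ⟨fun h => h.2, fun h => ⟨((Lp.stronglyMeasurable u).comp_measurable
        measurable_prodMk_right).aestronglyMeasurable, h⟩⟩
    rw [this]
    exact measurableSet_lt hm0 measurable_const
  classical
  have he : (fun s => edist (curryLp u s) g) = fun s =>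
      if MemLp (fun y => u (y, s)) 2 μ then eLpNorm (fun y => u (y, s) - g y) 2 μ
        else edist 0 g := by
    ext s
    by_cases h : MemLp (fun y => u (y, s)) 2 μ
    · rw [if_pos h, curryLp, dif_pos h, Lp.edist_def]
      refine eLpNorm_congr_ae ?_
      filter_upwards [h.coeFn_toLp] with y hy
      rw [Pi.sub_apply, hy]
    · rw [if_neg h, curryLp, dif_neg h]
  rw [he]
  exact Measurable.ite hset (hm g) measurable_const

variable [SFinite μ] [SFinite ν]

lemma coeFn_curryLp (u : Lp ℝ 2 (μ.prod ν)) :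
    ∀ᵐ s ∂ν, curryLp u s =ᵐ[μ] fun y => u (y, s) := by
  filter_upwards [ae_memLp_prodMk_right u] with s hs
  rw [curryLp, dif_pos hs]
  exact hs.coeFn_toLp

lemma curryLp_ae_eq_of_ae {u : Lp ℝ 2 (μ.prod ν)} {c : β → Lp ℝ 2 μ}
    (h : ∀ᵐ s ∂ν, c s =ᵐ[μ] fun y => u (y, s)) : curryLp u =ᵐ[ν] c := by
  filter_upwards [h, coeFn_curryLp u] with s h1 h2
  exact Lp.ext (h2.trans h1.symm)

lemma ae_ae_of_ae_prod_right {p : α × β → Prop} (h : ∀ᵐ z ∂μ.prod ν, p z) :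
    ∀ᵐ s ∂ν, ∀ᵐ y ∂μ, p (y, s) :=
  Measure.ae_ae_of_ae_prod (Measure.measurePreserving_swap.quasiMeasurePreserving.ae h)

lemma curryLp_add (u v : Lp ℝ 2 (μ.prod ν)) :
    curryLp (u + v) =ᵐ[ν] fun s => curryLp u s + curryLp v s := by
  refine curryLp_ae_eq_of_ae ?_
  filter_upwards [ae_ae_of_ae_prod_right (Lp.coeFn_add u v), coeFn_curryLp u, coeFn_curryLp v]
    with s h1 h2 h3
  filter_upwards [h1, h2, h3, Lp.coeFn_add (curryLp u s) (curryLp v s)] with y g1 g2 g3 g4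
  rw [g4, g1, Pi.add_apply, Pi.add_apply, g2, g3]

lemma curryLp_smul (c : ℝ) (u : Lp ℝ 2 (μ.prod ν)) :
    curryLp (c • u) =ᵐ[ν] fun s => c • curryLp u s := by
  refine curryLp_ae_eq_of_ae ?_
  filter_upwards [ae_ae_of_ae_prod_right (Lp.coeFn_smul c u), coeFn_curryLp u] with s h1 h2
  filter_upwards [h1, h2, Lp.coeFn_smul c (curryLp u s)] with y g1 g2 g4
  rw [g4, g1, Pi.smul_apply, Pi.smul_apply, g2]

lemma ae_inner_curryLp (u v : Lp ℝ 2 (μ.prod ν)) :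
    ∀ᵐ s ∂ν, ⟪curryLp u s, curryLp v s⟫ = ∫ y, u (y, s) * v (y, s) ∂μ := by
  filter_upwards [coeFn_curryLp u, coeFn_curryLp v] with s h1 h2
  rw [L2_inner_eq_integral]
  refine integral_congr_ae ?_
  filter_upwards [h1, h2] with y g1 g2
  rw [g1, g2]

lemma integral_inner_curryLp (u v : Lp ℝ 2 (μ.prod ν)) :
    ∫ s, ⟪curryLp u s, curryLp v s⟫ ∂ν = ⟪u, v⟫ := by
  rw [integral_congr_ae (ae_inner_curryLp u v), L2_inner_eq_integral,
    integral_prod_symm _ (L2_integrable_mul u v)]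

variable [MeasurableSpace.CountablyGenerated α]

lemma memLp_curryLp (u : Lp ℝ 2 (μ.prod ν)) : MemLp (curryLp u) 2 ν := by
  rw [memLp_two_iff_integrable_sq_norm (aestronglyMeasurable_curryLp u)]
  refine ((L2_integrable_mul u u).integral_prod_right).congr ?_
  filter_upwards [ae_inner_curryLp u u] with s hs
  rw [← hs, real_inner_self_eq_norm_sq]

/-- The isometry `L²(μ × ν) → L²(ν; L²(μ))`. -/
def curryIsometry : Lp ℝ 2 (μ.prod ν) →ₗᵢ[ℝ] Lp (Lp ℝ 2 μ) 2 ν where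
  toFun u := (memLp_curryLp u).toLp _
  map_add' u v := by
    rw [← MemLp.toLp_add]
    exact MemLp.toLp_congr _ _ (curryLp_add u v)
  map_smul' c u := by
    rw [RingHom.id_apply, ← MemLp.toLp_const_smul]
    exact MemLp.toLp_congr _ _ (curryLp_smul c u)
  norm_map' u := by
    refine (sq_eq_sq₀ (norm_nonneg _) (norm_nonneg _)).1 ?_
    simp only [LinearMap.coe_mk, AddHom.coe_mk]
    rw [← real_inner_self_eq_norm_sq, ← real_inner_self_eq_norm_sq, L2.inner_def,
      ← integral_inner_curryLp]
    refine integral_congr_ae ?_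
    filter_upwards [(memLp_curryLp u).coeFn_toLp] with s hs
    rw [hs]

/-- The range of an isometry of a complete space is closed. It contains `c 1_s`, the image of `c ⊗
1_s`, and is closed under sums, hence it is everything. -/
lemma curryIsometry_surjective :
    Function.Surjective (curryIsometry : Lp ℝ 2 (μ.prod ν) →ₗᵢ[ℝ] Lp (Lp ℝ 2 μ) 2 ν) := by
  intro c
  refine Lp.induction (p := 2) (by norm_num)
    (motive := fun c => ∃ u : Lp ℝ 2 (μ.prod ν), curryIsometry u = c) ?_ ?_ ?_ c
  · intro c s hs hμs
    refine ⟨tensor c (indicatorConstLp 2 hs hμs.ne 1), ?_⟩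
    rw [Lp.simpleFunc.coe_indicatorConst]
    refine Lp.ext ?_
    refine (memLp_curryLp _).coeFn_toLp.trans (curryLp_ae_eq_of_ae ?_)
    filter_upwards [ae_ae_of_ae_prod_right (coeFn_tensor c (indicatorConstLp 2 hs hμs.ne (1 : ℝ))),
      indicatorConstLp_coeFn (p := 2) (hs := hs) (hμs := hμs.ne) (c := (1 : ℝ)),
      indicatorConstLp_coeFn (p := 2) (hs := hs) (hμs := hμs.ne) (c := c)] with t h1 h2 h3
    rw [h3]
    by_cases ht : t ∈ s
    · rw [indicator_of_mem ht]
      filter_upwards [h1] with y hy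
      rw [hy, h2, indicator_of_mem ht, mul_one]
    · rw [indicator_of_notMem ht]
      filter_upwards [h1, Lp.coeFn_zero ℝ 2 μ] with y hy h0
      rw [hy, h2, indicator_of_notMem ht, mul_zero, h0, Pi.zero_apply]
  · rintro f g hf hg - ⟨u, hu⟩ ⟨v, hv⟩
    exact ⟨u + v, by rw [map_add, hu, hv]⟩
  · exact curryIsometry.isometry.isClosedEmbedding.isClosed_range

/-- Every `c ∈ L²(ν; L²(μ))` is the family of sections of some `u ∈ L²(μ × ν)`. -/
lemma exists_curryLp_eq {c : β → Lp ℝ 2 μ} (hc : MemLp c 2 ν) :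
    ∃ u : Lp ℝ 2 (μ.prod ν), curryLp u =ᵐ[ν] c := by
  obtain ⟨u, hu⟩ := curryIsometry_surjective (hc.toLp c)
  refine ⟨u, (memLp_curryLp u).coeFn_toLp.symm.trans (EventuallyEq.trans ?_ hc.coeFn_toLp)⟩
  rw [← hu]
  rfl

end Curry

end L2

end DeepIDE

end

noncomputable section

namespace DeepIDE

open Filter Topology
open scoped NNReal RealInnerProductSpace

lemma integral_congr_of_ae_Ioo {E : Type*} [NormedAddCommGroup E] [NormedSpace ℝ E]
    {F G : ℝ → E} {a b T : ℝ} (h : ∀ᵐ s ∂volume.restrict (Ioo 0 T), F s = G s)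
    (ha : 0 ≤ a) (hab : a ≤ b) (hb : b ≤ T) : ∫ s in a..b, F s = ∫ s in a..b, G s := by
  refine intervalIntegral.integral_congr_ae ?_
  rw [uIoc_of_le hab]
  filter_upwards [ae_mem_Ioc_of_ae_Ioo h le_rfl] with s hs hs'
  exact hs ⟨ha.trans_lt hs'.1, hs'.2.trans hb⟩

/-! ### Final value problems by time reversal. -/

section Backward

lemma measurePreserving_reflect (T : ℝ) : MeasurePreserving (fun s => T - s)
    (volume.restrict (Ioo 0 T)) (volume.restrict (Ioo 0 T)) := by
  have h := (Measure.measurePreserving_sub_left (volume : Measure ℝ) T).restrict_preimage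
    (measurableSet_Ioo (a := 0) (b := T))
  have h2 : (fun s => T - s) ⁻¹' Ioo 0 T = Ioo 0 T := by
    rw [preimage_const_sub_Ioo, sub_self, sub_zero]
  rwa [h2] at h

variable {H : Type*} [NormedAddCommGroup H] [NormedSpace ℝ H]

/-- `r` solves `r' = G(t, r)` on `[0,T]`, in integrated form starting from the final time. -/
structure IsFinalValueSolution (T : ℝ) (G : ℝ → H → H) (r : ℝ → H) : Prop where
  continuousOn : ContinuousOn r (Icc 0 T)
  integrable : Integrable (fun s => G s (r s)) (volume.restrict (Ioo 0 T))
  eq : ∀ t ∈ Icc 0 T, r t = r T - ∫ s in t..T, G s (r s)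

variable {T : ℝ} {G : ℝ → H → H}

lemma reflect_mem_Icc {t : ℝ} (ht : t ∈ Icc 0 T) : T - t ∈ Icc 0 T :=
  ⟨sub_nonneg.2 ht.2, sub_le_self _ ht.1⟩

lemma continuousOn_reflect {E : Type*} [TopologicalSpace E] {r : ℝ → E} (hr : ContinuousOn r (Icc 0 T)) :
    ContinuousOn (fun t => r (T - t)) (Icc 0 T) :=
  hr.comp (Continuous.continuousOn (by fun_prop)) fun _ ht => reflect_mem_Icc ht

/-- The substitution `t ↦ T - t` preserves the measure on `(0,T)` and changes the sign of the field,
so the initial value theory applies. -/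
lemma IsFinalValueSolution.reflect {r : ℝ → H} (hr : IsFinalValueSolution T G r) :
    IsIntegralSolution T (fun s x => -G (T - s) x) (r T) (fun t => r (T - t)) where
  continuousOn := continuousOn_reflect hr.continuousOn
  integrable := ((measurePreserving_reflect T).integrable_comp_of_integrable hr.integrable).neg
  eq t ht := by
    rw [intervalIntegral.integral_neg,
      intervalIntegral.integral_comp_sub_left (fun s => G s (r s)) T, sub_zero,
      hr.eq _ (reflect_mem_Icc ht), sub_eq_add_neg]

lemma IsIntegralSolution.reflect (hT : 0 ≤ T) {q : ℝ → H} {x₀ : H}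
    (hq : IsIntegralSolution T (fun s x => -G (T - s) x) x₀ q) :
    IsFinalValueSolution T G (fun t => q (T - t)) ∧ q 0 = x₀ := by
  have h0 : q 0 = x₀ := by
    rw [hq.eq 0 ⟨le_rfl, hT⟩, intervalIntegral.integral_same, add_zero]
  refine ⟨⟨continuousOn_reflect hq.continuousOn, ?_, fun t ht => ?_⟩, h0⟩
  · have := ((measurePreserving_reflect T).integrable_comp_of_integrable hq.integrable).neg
    refine this.congr (ae_of_all _ fun s => ?_)
    simp
  · have h1 := intervalIntegral.integral_comp_sub_left (a := 0) (b := T - t)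
      (fun s => G s (q (T - s))) T
    simp only [sub_sub_cancel, sub_zero] at h1
    rw [sub_self, h0, hq.eq _ (reflect_mem_Icc ht), intervalIntegral.integral_neg, h1,
      sub_eq_add_neg]

lemma IsFinalValueSolution.eqOn {k : ℝ → ℝ} {q r : ℝ → H}
    (hk : MemLp k 2 (volume.restrict (Ioo 0 T))) (hk0 : ∀ s, 0 ≤ k s)
    (hG : ∀ s x y, ‖G s x - G s y‖ ≤ k s * ‖x - y‖)
    (hq : IsFinalValueSolution T G q) (hr : IsFinalValueSolution T G r) (hqr : q T = r T) :
    EqOn q r (Icc 0 T) := by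
  intro t ht
  have hq' := hq.reflect
  rw [hqr] at hq'
  have := hq'.eqOn (k := fun s => k (T - s)) (hk.comp_measurePreserving (measurePreserving_reflect T))
    (fun s => hk0 _) (ae_of_all _ fun s x y => ?_) hr.reflect (reflect_mem_Icc ht)
  · simpa using this
  · rw [neg_sub_neg, norm_sub_rev x y]
    exact hG _ _ _

lemma exists_isFinalValueSolution [CompleteSpace H] (hT : 0 ≤ T) {k : ℝ → ℝ} (x₀ : H)
    (hk : MemLp k 2 (volume.restrict (Ioo 0 T)))
    (hG : ∀ s x y, ‖G s x - G s y‖ ≤ k s * ‖x - y‖)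
    (hGi : ∀ x : ℝ → H, ContinuousOn x (Icc 0 T) →
      Integrable (fun s => G s (x s)) (volume.restrict (Ioo 0 T))) :
    ∃ r, IsFinalValueSolution T G r ∧ r T = x₀ := by
  obtain ⟨q, hq⟩ := exists_isIntegralSolution (G := fun s x => -G (T - s) x) hT x₀
    (hk.comp_measurePreserving (measurePreserving_reflect T))
    (ae_of_all _ fun s x y => by
      rw [neg_sub_neg, norm_sub_rev x y]
      exact hG _ _ _)
    (fun x hx => by
      have := (measurePreserving_reflect T).integrable_comp_of_integrable
        (hGi _ (continuousOn_reflect hx))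
      refine this.neg.congr (ae_of_all _ fun s => ?_)
      simp)
  have h := hq.reflect hT
  exact ⟨_, h.1, by simpa using h.2⟩

end Backward

/-! ### The adjoint equation and its duality with the linearized one. -/

section Adjoint

lemma memLp_linearization_apply {H : Type*} [NormedAddCommGroup H] [NormedSpace ℝ H]
    {L : ℝ≥0} {N : H → H} {N' : H → H →L[ℝ] H} {T : ℝ} {A : ℝ → H} {B : ℝ → H →L[ℝ] H}
    {f r : ℝ → H} (hN : LipschitzWith L N)
    (hN' : ∀ x h, HasLineDerivAt ℝ N (N' x h) x h)
    (hA : MemLp A 2 (volume.restrict (Ioo 0 T))) (hB : MemLp B 2 (volume.restrict (Ioo 0 T)))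
    (hf : ContinuousOn f (Icc 0 T)) (hr : ContinuousOn r (Icc 0 T)) :
    MemLp (fun s => N' (A s - B s (f s)) (r s)) ⊤ (volume.restrict (Ioo 0 T)) :=
  (memLp_top_of_continuousOn hr).of_le_mul (c := L)
    (aestronglyMeasurable_of_hasLineDerivAt hN.continuous (hA.sub (memLp_clm_apply hB hf)).1
      (aestronglyMeasurable_Ioo_of_continuousOn hr) (ae_of_all _ fun _ => hN' _ _))
    (ae_of_all _ fun _ => norm_le_of_lipschitzWith_of_hasLineDerivAt hN (hN' _ _))

variable {H : Type*} [NormedAddCommGroup H] [InnerProductSpace ℝ H] [CompleteSpace H]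
  {L : ℝ≥0} {N : H → H} {N' : H → H →L[ℝ] H} {T : ℝ} {A A' : ℝ → H} {B B' : ℝ → H →L[ℝ] H}
  {f g r : ℝ → H}

/-- The right-hand side `B(s)* N'(ξ(s)) x` of the adjoint problem. -/
def adjointField (N' : H → H →L[ℝ] H) (A : ℝ → H) (B : ℝ → H →L[ℝ] H) (f : ℝ → H)
    (s : ℝ) (x : H) : H :=
  ContinuousLinearMap.adjoint (B s) (N' (A s - B s (f s)) x)

lemma norm_adjointField_sub_le (hN : LipschitzWith L N)
    (hN' : ∀ x h, HasLineDerivAt ℝ N (N' x h) x h) (s : ℝ) (x y : H) :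
    ‖adjointField N' A B f s x - adjointField N' A B f s y‖ ≤ L * ‖B s‖ * ‖x - y‖ := by
  rw [adjointField, adjointField, ← map_sub, ← map_sub]
  refine (ContinuousLinearMap.le_opNorm _ _).trans ?_
  rw [LinearIsometryEquiv.norm_map, mul_comm (L : ℝ), mul_assoc]
  gcongr
  exact norm_le_of_lipschitzWith_of_hasLineDerivAt hN (hN' _ _)

lemma integrable_adjointField (hN : LipschitzWith L N)
    (hN' : ∀ x h, HasLineDerivAt ℝ N (N' x h) x h)
    (hA : MemLp A 2 (volume.restrict (Ioo 0 T))) (hB : MemLp B 2 (volume.restrict (Ioo 0 T)))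
    (hf : ContinuousOn f (Icc 0 T)) (hr : ContinuousOn r (Icc 0 T)) :
    Integrable (fun s => adjointField N' A B f s (r s)) (volume.restrict (Ioo 0 T)) := by
  have h1 := memLp_linearization_apply hN hN' hA hB hf hr
  obtain ⟨C, hC⟩ := isCompact_Icc.exists_bound_of_continuousOn hr
  refine (((hB.integrable (by norm_num)).norm.mul_const (L * C))).mono'
    (isBoundedBilinearMap_apply.continuous.comp_aestronglyMeasurable
      ((ContinuousLinearMap.adjoint.continuous.comp_aestronglyMeasurable hB.1).prodMk h1.1)) ?_
  filter_upwards [ae_restrict_mem measurableSet_Ioo] with s hs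
  refine (ContinuousLinearMap.le_opNorm _ _).trans ?_
  rw [LinearIsometryEquiv.norm_map]
  gcongr
  refine (norm_le_of_lipschitzWith_of_hasLineDerivAt hN (hN' _ _)).trans ?_
  gcongr
  exact hC s (Ioo_subset_Icc_self hs)

/-- The duality between the linearized and the adjoint problem. -/
theorem inner_linearized_adjoint (hT : 0 ≤ T) (hNs : ∀ x h k, ⟪N' x h, k⟫ = ⟪h, N' x k⟫)
    (hg : IsIntegralSolution T (linearizedField N' A A' B B' f) 0 g)
    (hr : IsFinalValueSolution T (adjointField N' A B f) r) :
    ⟪g T, r T⟫ = ∫ s in Ioo 0 T, ⟪A' s - B' s (f s), N' (A s - B s (f s)) (r s)⟫ := by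
  rw [inner_eq_integral_of_primitives hT hg.integrable hr.integrable
    (fun t ht => by rw [hg.eq t ht, zero_add]) hr.eq]
  congr 1; ext s
  -- Moving `N'(ξ)` to `r` by symmetry and `B*` back to `g` produces `-⟪B g, N'(ξ) r⟫ + ⟪B g, N'(ξ)
  -- r⟫`, which vanishes.
  rw [linearizedField, adjointField, hNs, ContinuousLinearMap.adjoint_inner_right, inner_sub_left,
    sub_add_cancel]

end Adjoint

end DeepIDE

end

/-! ### The learning problem as an evolution equation in `L²(Y)`. -/

noncomputable section

namespace DeepIDE

open Filter Topology
open scoped NNReal RealInnerProductSpace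

section Assoc

variable {α β γ : Type*} [MeasurableSpace α] [MeasurableSpace β] [MeasurableSpace γ]
  {μ : Measure α} {ν : Measure β} {ρ : Measure γ} [SFinite ν] [SFinite ρ]

/-- The reassociation `L²(μ × (ν × ρ)) → L²((μ × ν) × ρ)`. -/
def assocLp : Lp ℝ 2 (μ.prod (ν.prod ρ)) →ₗᵢ[ℝ] Lp ℝ 2 ((μ.prod ν).prod ρ) :=
  Lp.compMeasurePreservingₗᵢ ℝ MeasurableEquiv.prodAssoc (measurePreserving_prodAssoc μ ν ρ)

lemma coeFn_assocLp (b : Lp ℝ 2 (μ.prod (ν.prod ρ))) :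
    assocLp b =ᵐ[(μ.prod ν).prod ρ] fun z => b (z.1.1, z.1.2, z.2) :=
  Lp.coeFn_compMeasurePreserving b (measurePreserving_prodAssoc μ ν ρ)

lemma assocLp_surjective : Function.Surjective
    (assocLp : Lp ℝ 2 (μ.prod (ν.prod ρ)) →ₗᵢ[ℝ] Lp ℝ 2 ((μ.prod ν).prod ρ)) := by
  intro u
  have h := (measurePreserving_prodAssoc μ ν ρ).symm
  refine ⟨Lp.compMeasurePreserving _ h u, Lp.ext ?_⟩
  refine (coeFn_assocLp _).trans ?_
  have h1 := (measurePreserving_prodAssoc μ ν ρ).quasiMeasurePreserving.ae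
    (Lp.coeFn_compMeasurePreserving u h)
  filter_upwards [h1] with z hz
  exact hz

/-- `curryLp` freezes the second factor of a product; reassociating first makes that factor time
alone. -/
lemma ae_section_assocLp [SFinite μ] [MeasurableSpace.CountablyGenerated α]
    [MeasurableSpace.CountablyGenerated β] (b : Lp ℝ 2 (μ.prod (ν.prod ρ))) :
    ∀ᵐ s ∂ρ, curryLp (assocLp b) s =ᵐ[μ.prod ν] fun z => b (z.1, z.2, s) := by
  filter_upwards [coeFn_curryLp (assocLp b), ae_ae_of_ae_prod_right (coeFn_assocLp b)] with s h1 h2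
  exact h1.trans h2

end Assoc

lemma IsIntegralSolution.congr {H : Type*} [NormedAddCommGroup H] [NormedSpace ℝ H] {T : ℝ}
    {G G' : ℝ → H → H} {x₀ : H} {x : ℝ → H} (hx : IsIntegralSolution T G x₀ x)
    (h : ∀ᵐ s ∂volume.restrict (Ioo 0 T), ∀ y, G s y = G' s y) :
    IsIntegralSolution T G' x₀ x where
  continuousOn := hx.continuousOn
  integrable := hx.integrable.congr (by filter_upwards [h] with s hs using hs _)
  eq t ht := by
    rw [hx.eq t ht]
    congr 1
    exact integral_congr_of_ae_Ioo (by filter_upwards [h] with s hs using hs _) le_rfl ht.1 ht.2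

namespace LearningData

variable {d l N : ℕ} (S : LearningData d l N)

/-- The bias `a` as a path in `L²(Y)`. -/
def biasPath (a : S.BiasSpace) : ℝ → S.State := curryLp a

/-- The weight `b` as a path of Hilbert–Schmidt operators on `L²(Y)`. -/
def weightPath (b : S.WeightSpace) (s : ℝ) : S.State →L[ℝ] S.State :=
  kernelOp (curryLp (assocLp b) s)

/-- The network output as an element of `L²(U)`. -/
def outputLp (p : S.Params) (j : Fin N) : S.OutputBiasSpace :=
  kernelOp p.2.2.1 (S.forward p.1 p.2.1 j S.T) + p.2.2.2

variable {S}

lemma memLp_biasPath (a : S.BiasSpace) : MemLp (S.biasPath a) 2 S.μT := memLp_curryLp a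

lemma memLp_weightPath (b : S.WeightSpace) : MemLp (S.weightPath b) 2 S.μT :=
  kernelOp.comp_memLp' (memLp_curryLp (assocLp b))

lemma biasPath_add_smul (a α : S.BiasSpace) (ε : ℝ) :
    ∀ᵐ s ∂S.μT, S.biasPath (a + ε • α) s = S.biasPath a s + ε • S.biasPath α s := by
  filter_upwards [curryLp_add a (ε • α), curryLp_smul ε α] with s h1 h2
  rw [biasPath, h1, h2]; rfl

lemma weightPath_add_smul (b β : S.WeightSpace) (ε : ℝ) :
    ∀ᵐ s ∂S.μT, S.weightPath (b + ε • β) s = S.weightPath b s + ε • S.weightPath β s := by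
  filter_upwards [curryLp_add (assocLp b) (ε • assocLp β), curryLp_smul ε (assocLp β)] with s h1 h2
  rw [weightPath, map_add, map_smul, h1, h2, map_add, map_smul]; rfl

/-- The exceptional set of times is chosen before `φ`, so that `φ` may later be the state at time
`s` itself. -/
lemma coeFn_weightPath (b : S.WeightSpace) : ∀ᵐ s ∂S.μT, ∀ φ : S.State,
    S.weightPath b s φ =ᵐ[S.μY] fun y => ∫ z, b (y, z, s) * φ z ∂S.μY := by
  filter_upwards [ae_section_assocLp b] with s hs φ
  filter_upwards [coeFn_kernelOp (curryLp (assocLp b) s) φ, Measure.ae_ae_of_ae_prod hs]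
    with y h1 h2
  rw [weightPath, h1]
  refine integral_congr_ae ?_
  filter_upwards [h2] with z hz
  rw [hz]

lemma coeFn_adjoint_weightPath (b : S.WeightSpace) : ∀ᵐ s ∂S.μT, ∀ φ : S.State,
    ContinuousLinearMap.adjoint (S.weightPath b s) φ
      =ᵐ[S.μY] fun y => ∫ z, b (z, y, s) * φ z ∂S.μY := by
  filter_upwards [ae_section_assocLp b] with s hs φ
  filter_upwards [coeFn_adjoint_kernelOp (curryLp (assocLp b) s) φ, ae_ae_of_ae_prod_right hs]
    with y h1 h2
  rw [weightPath, h1]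
  refine integral_congr_ae ?_
  filter_upwards [h2] with z hz
  rw [hz]

lemma coeFn_preActivation (a : S.BiasSpace) (b : S.WeightSpace) : ∀ᵐ s ∂S.μT, ∀ φ : S.State,
    (S.biasPath a s - S.weightPath b s φ : S.State) =ᵐ[S.μY] S.preActivation a b φ s := by
  filter_upwards [coeFn_weightPath b, coeFn_curryLp a] with s h1 h2 φ
  filter_upwards [h1 φ, h2, Lp.coeFn_sub (S.biasPath a s) (S.weightPath b s φ)] with y g1 g2 g3
  rw [g3, Pi.sub_apply, g1, biasPath, g2, preActivation]

variable {L : ℝ≥0}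

lemma coeFn_nemytskiiDeriv_xi (hσ : LipschitzWith L S.σ) (a : S.BiasSpace) (b : S.WeightSpace)
    (j : Fin N) : ∀ᵐ s ∂S.μT, ∀ φ : S.State,
      nemytskiiDeriv hσ (S.biasPath a s - S.weightPath b s (S.forward a b j s)) φ
        =ᵐ[S.μY] fun y => deriv S.σ (S.xi a b j y s) * φ y := by
  filter_upwards [coeFn_preActivation a b] with s hs φ
  filter_upwards [hs (S.forward a b j s), coeFn_nemytskiiDeriv hσ
    (S.biasPath a s - S.weightPath b s (S.forward a b j s)) φ] with y h1 h2
  rw [h2, h1, xi]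

lemma coeFn_adjointField (hσ : LipschitzWith L S.σ) (a : S.BiasSpace) (b : S.WeightSpace)
    (j : Fin N) : ∀ᵐ s ∂S.μT, ∀ φ : S.State,
      (adjointField (nemytskiiDeriv hσ) (S.biasPath a) (S.weightPath b) (S.forward a b j) s φ :
        S.State) =ᵐ[S.μY] fun y => ∫ z, b (z, y, s) * (deriv S.σ (S.xi a b j z s) * φ z) ∂S.μY := by
  filter_upwards [coeFn_nemytskiiDeriv_xi hσ a b j, coeFn_adjoint_weightPath b] with s h1 h2 φ
  refine (h2 _).trans (ae_of_all _ fun y => integral_congr_ae ?_)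
  filter_upwards [h1 φ] with z hz
  rw [hz]

lemma coeFn_outputLp (p : S.Params) (j : Fin N) : S.outputLp p j =ᵐ[S.μU] S.output p j := by
  obtain ⟨a, b, w, μ⟩ := p
  filter_upwards [Lp.coeFn_add (kernelOp w (S.forward a b j S.T)) μ,
    coeFn_kernelOp w (S.forward a b j S.T)] with u h1 h2
  rw [outputLp, h1, Pi.add_apply, h2, output]

section Forward

variable [IsFiniteMeasure S.μY]

lemma coeFn_forwardField (hσ : LipschitzWith L S.σ) (a : S.BiasSpace) (b : S.WeightSpace) :
    ∀ᵐ s ∂S.μT, ∀ φ : S.State,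
      (forwardField (nemytskii S.μY hσ) (S.biasPath a) (S.weightPath b) s φ : S.State)
        =ᵐ[S.μY] fun y => S.σ (S.preActivation a b φ s y) := by
  filter_upwards [coeFn_preActivation a b] with s hs φ
  filter_upwards [hs φ, coeFn_nemytskii hσ (S.biasPath a s - S.weightPath b s φ)] with y h1 h2
  rw [forwardField, h2, h1]

/-- The integrand `F` is determined for almost every time by its pointwise description, so it can be
replaced by the abstract field. All the abstract theory is imported through this equivalence. -/
lemma isForwardSolution_iff (hσ : LipschitzWith L S.σ) (a : S.BiasSpace) (b : S.WeightSpace)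
    (j : Fin N) (f : ℝ → S.State) :
    S.IsForwardSolution a b j f ↔ IsIntegralSolution S.T
      (forwardField (nemytskii S.μY hσ) (S.biasPath a) (S.weightPath b)) (S.fI j) f := by
  constructor
  · rintro ⟨hc, F, hF, hFe, hf⟩
    have he : ∀ᵐ s ∂S.μT,
        F s = forwardField (nemytskii S.μY hσ) (S.biasPath a) (S.weightPath b) s (f s) := by
      filter_upwards [hFe, coeFn_forwardField hσ a b] with s h1 h2
      exact Lp.ext (h1.trans (h2 (f s)).symm)
    refine ⟨hc, hF.congr he, fun t ht => ?_⟩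
    rw [hf t ht, integral_congr_of_ae_Ioo he le_rfl ht.1 ht.2]
  · rintro ⟨hc, hi, hf⟩
    refine ⟨hc, _, hi, ?_, hf⟩
    filter_upwards [coeFn_forwardField hσ a b] with s hs using hs _

lemma isForwardSolution_forward (hσ : LipschitzWith L S.σ) (hT : 0 ≤ S.T) (a : S.BiasSpace)
    (b : S.WeightSpace) (j : Fin N) : S.IsForwardSolution a b j (S.forward a b j) := by
  obtain ⟨f, hf⟩ := exists_forward hT (lipschitzWith_nemytskii hσ) (memLp_biasPath a)
    (memLp_weightPath b) (S.fI j)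
  exact Classical.epsilon_spec (p := S.IsForwardSolution a b j)
    ⟨f, (isForwardSolution_iff hσ a b j f).2 hf⟩

lemma IsForwardSolution.eqOn (hσ : LipschitzWith L S.σ) {a : S.BiasSpace} {b : S.WeightSpace}
    {j : Fin N} {f g : ℝ → S.State} (hf : S.IsForwardSolution a b j f)
    (hg : S.IsForwardSolution a b j g) : EqOn f g (Icc 0 S.T) := by
  have hf' := (isForwardSolution_iff hσ a b j f).1 hf
  have hg' := (isForwardSolution_iff hσ a b j g).1 hg
  have hk : MemLp (fun s => (L : ℝ) * ‖S.weightPath b s‖) 2 (volume.restrict (Ioo 0 S.T)) :=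
    memLp_kernel (memLp_weightPath b)
  exact hf'.eqOn hk (fun _ => mul_nonneg L.2 (norm_nonneg _))
    (ae_of_all _ (norm_forwardField_sub_le (lipschitzWith_nemytskii hσ))) hg'

/-- The derivative of the network output along a line in parameter space. -/
lemma exists_hasDerivAt_outputLp (hσ : LipschitzWith L S.σ) (hσd : Differentiable ℝ S.σ)
    (hT : 0 ≤ S.T) (a α : S.BiasSpace) (b β : S.WeightSpace) (w v : S.OutputWeightSpace)
    (μ φ : S.OutputBiasSpace) (j : Fin N) :
    ∃ g, IsIntegralSolution S.T (linearizedField (nemytskiiDeriv hσ) (S.biasPath a) (S.biasPath α)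
        (S.weightPath b) (S.weightPath β) (S.forward a b j)) 0 g ∧
      HasDerivAt (fun ε : ℝ => S.outputLp ((a, b, w, μ) + ε • (α, β, v, φ)) j)
        (kernelOp v (S.forward a b j S.T) + kernelOp w (g S.T) + φ) 0 := by
  have hN := lipschitzWith_nemytskii (μ := S.μY) hσ
  have hN' := hasLineDerivAt_nemytskii (μ := S.μY) hσ hσd
  obtain ⟨g, hg⟩ := exists_linearized hT hN hN' (memLp_biasPath a) (memLp_weightPath b)
    (memLp_biasPath α) (memLp_weightPath β) (isForwardSolution_forward hσ hT a b j).continuousOn 0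
  refine ⟨g, hg, ?_⟩
  -- Sections are linear only up to a null set of times depending on `ε`, which an integral equation
  -- does not see.
  have hf : ∀ ε : ℝ, IsIntegralSolution S.T (forwardField (nemytskii S.μY hσ)
      (fun s => S.biasPath a s + ε • S.biasPath α s)
      (fun s => S.weightPath b s + ε • S.weightPath β s)) (S.fI j)
      (S.forward (a + ε • α) (b + ε • β) j) := fun ε => by
    refine ((isForwardSolution_iff hσ _ _ j _).1
      (isForwardSolution_forward hσ hT (a + ε • α) (b + ε • β) j)).congr ?_
    filter_upwards [biasPath_add_smul a α ε, weightPath_add_smul b β ε] with s h1 h2 y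
    rw [forwardField, forwardField, h1, h2]
  have h0 : S.forward (a + (0 : ℝ) • α) (b + (0 : ℝ) • β) j = S.forward a b j := by
    rw [zero_smul, zero_smul, add_zero, add_zero]
  have hd : HasDerivAt (fun ε : ℝ => S.forward (a + ε • α) (b + ε • β) j S.T) (g S.T) 0 :=
    hasDerivAt_forward (f := fun ε => S.forward (a + ε • α) (b + ε • β) j) hN hN'
      (memLp_biasPath a) (memLp_weightPath b) (memLp_biasPath α)
      (memLp_weightPath β) hf (by rw [h0]; exact hg) ⟨hT, le_rfl⟩
  have hlin : ∀ {E : Type} [NormedAddCommGroup E] [NormedSpace ℝ E] (x y : E),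
      HasDerivAt (fun ε : ℝ => x + ε • y) y 0 := fun x y => by
    simpa using ((hasDerivAt_id (0 : ℝ)).smul_const y).const_add x
  have hw : HasDerivAt (fun ε : ℝ => kernelOp (w + ε • v)) (kernelOp v) 0 := by
    simp_rw [map_add, map_smul]
    exact hlin _ _
  have hfin := (hw.clm_apply hd).add (hlin μ φ)
  rw [zero_smul, zero_smul, zero_smul, add_zero, add_zero, add_zero] at hfin
  exact hfin

end Forward

section Backward

variable [IsFiniteMeasure S.μU] {K : ℝ≥0}

lemma coeFn_predicted (hh : LipschitzWith K S.h) (p : S.Params) (j : Fin N) :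
    nemytskii S.μU hh (S.outputLp p j) =ᵐ[S.μU] S.predicted p j := by
  filter_upwards [coeFn_nemytskii hh (S.outputLp p j), coeFn_outputLp p j] with u h1 h2
  rw [h1, h2, predicted]

/-- `(P_pre⁽ʲ⁾ - P⁽ʲ⁾) h'(Z⁽ʲ⁾)` as an element of `L²(U)`. -/
def residualLp (hh : LipschitzWith K S.h) (p : S.Params) (j : Fin N) : S.OutputBiasSpace :=
  nemytskiiDeriv hh (S.outputLp p j) (nemytskii S.μU hh (S.outputLp p j) - S.P j)

lemma coeFn_residualLp (hh : LipschitzWith K S.h) (p : S.Params) (j : Fin N) :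
    residualLp hh p j =ᵐ[S.μU] S.residual p j := by
  filter_upwards [coeFn_nemytskiiDeriv hh (S.outputLp p j)
      (nemytskii S.μU hh (S.outputLp p j) - S.P j), coeFn_outputLp p j, coeFn_predicted hh p j,
    Lp.coeFn_sub (nemytskii S.μU hh (S.outputLp p j)) (S.P j)] with u h1 h2 h3 h4
  rw [residualLp, h1, h2, h4, Pi.sub_apply, h3, residual, mul_comm]

lemma coeFn_adjoint_residualLp (hh : LipschitzWith K S.h) (p : S.Params) (j : Fin N) :
    ContinuousLinearMap.adjoint (kernelOp p.2.2.1) (residualLp hh p j)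
      =ᵐ[S.μY] fun y => ∫ u, S.residual p j u * p.2.2.1 (u, y) ∂S.μU := by
  refine (coeFn_adjoint_kernelOp _ _).trans (ae_of_all _ fun y => integral_congr_ae ?_)
  filter_upwards [coeFn_residualLp hh p j] with u hu
  rw [hu, mul_comm]

lemma isBackwardSolution_iff (hσ : LipschitzWith L S.σ) (hh : LipschitzWith K S.h)
    (p : S.Params) (j : Fin N) (r : ℝ → S.State) :
    S.IsBackwardSolution p j r ↔
      r S.T = ContinuousLinearMap.adjoint (kernelOp p.2.2.1) (residualLp hh p j) ∧
      IsFinalValueSolution S.T (adjointField (nemytskiiDeriv hσ) (S.biasPath p.1)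
        (S.weightPath p.2.1) (S.forward p.1 p.2.1 j)) r := by
  constructor
  · rintro ⟨hc, hfin, R, hR, hRe, hr⟩
    have he : ∀ᵐ s ∂S.μT, R s = adjointField (nemytskiiDeriv hσ) (S.biasPath p.1)
        (S.weightPath p.2.1) (S.forward p.1 p.2.1 j) s (r s) := by
      filter_upwards [hRe, coeFn_adjointField hσ p.1 p.2.1 j] with s h1 h2
      exact Lp.ext (h1.trans (h2 (r s)).symm)
    refine ⟨Lp.ext (hfin.trans (coeFn_adjoint_residualLp hh p j).symm), hc, hR.congr he,
      fun t ht => ?_⟩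
    rw [hr t ht, integral_congr_of_ae_Ioo he ht.1 ht.2 le_rfl]
  · rintro ⟨hfin, hc, hi, hr⟩
    refine ⟨hc, ?_, _, hi, ?_, hr⟩
    · rw [hfin]; exact coeFn_adjoint_residualLp hh p j
    · filter_upwards [coeFn_adjointField hσ p.1 p.2.1 j] with s hs using hs _

lemma integral_sq_eq_norm_sq (hh : LipschitzWith K S.h) (p : S.Params) (j : Fin N) :
    ∫ u, |S.predicted p j u - S.P j u| ^ 2 ∂S.μU
      = ‖nemytskii S.μU hh (S.outputLp p j) - S.P j‖ ^ 2 := by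
  rw [L2_norm_sq_eq_integral]
  refine integral_congr_ae ?_
  filter_upwards [coeFn_predicted hh p j,
    Lp.coeFn_sub (nemytskii S.μU hh (S.outputLp p j)) (S.P j)] with u h1 h2
  rw [h2, Pi.sub_apply, h1, sq_abs]

variable [IsFiniteMeasure S.μY]

lemma exists_isBackwardSolution (hσ : LipschitzWith L S.σ) (hσd : Differentiable ℝ S.σ)
    (hh : LipschitzWith K S.h) (hT : 0 ≤ S.T) (p : S.Params) (j : Fin N) :
    ∃ r, S.IsBackwardSolution p j r := by
  have hf := (isForwardSolution_forward hσ hT p.1 p.2.1 j).continuousOn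
  obtain ⟨r, hr, hrT⟩ := exists_isFinalValueSolution hT
    (ContinuousLinearMap.adjoint (kernelOp p.2.2.1) (residualLp hh p j))
    (memLp_kernel (L := L) (memLp_weightPath p.2.1))
    (norm_adjointField_sub_le (A := S.biasPath p.1) (f := S.forward p.1 p.2.1 j)
      (lipschitzWith_nemytskii hσ) (hasLineDerivAt_nemytskii hσ hσd))
    (fun x hx => integrable_adjointField (lipschitzWith_nemytskii hσ)
      (hasLineDerivAt_nemytskii hσ hσd) (memLp_biasPath p.1) (memLp_weightPath p.2.1) hf hx)
  exact ⟨r, (isBackwardSolution_iff hσ hh p j r).2 ⟨hrT, hr⟩⟩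

lemma IsBackwardSolution.eqOn (hσ : LipschitzWith L S.σ) (hσd : Differentiable ℝ S.σ)
    (hh : LipschitzWith K S.h) {p : S.Params} {j : Fin N} {q r : ℝ → S.State}
    (hq : S.IsBackwardSolution p j q) (hr : S.IsBackwardSolution p j r) :
    EqOn q r (Icc 0 S.T) := by
  obtain ⟨hqT, hq⟩ := (isBackwardSolution_iff hσ hh p j q).1 hq
  obtain ⟨hrT, hr⟩ := (isBackwardSolution_iff hσ hh p j r).1 hr
  exact hq.eqOn (k := fun s => L * ‖S.weightPath p.2.1 s‖) (memLp_kernel (memLp_weightPath p.2.1))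
    (fun _ => mul_nonneg L.2 (norm_nonneg _))
    (norm_adjointField_sub_le (lipschitzWith_nemytskii hσ) (hasLineDerivAt_nemytskii hσ hσd))
    hr (hqT.trans hrT.symm)

end Backward

end LearningData

end DeepIDE

end

/-! ### The gradients as functions, and the derivative for one training pair. -/

noncomputable section

namespace DeepIDE

open Filter Topology
open scoped NNReal RealInnerProductSpace

lemma integrable_inner_of_memLp {α H : Type*} [MeasurableSpace α] {μ : Measure α}
    [NormedAddCommGroup H] [InnerProductSpace ℝ H] {u v : α → H} (hu : MemLp u 2 μ)
    (hv : MemLp v 2 μ) : Integrable (fun s => ⟪u s, v s⟫) μ :=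
  (hu.norm.integrable_mul hv.norm).mono' (hu.1.inner hv.1)
    (ae_of_all _ fun _ => norm_inner_le_norm _ _)

lemma memLp_tensor_path {α β : Type*} [MeasurableSpace α] [MeasurableSpace β] {μ : Measure α}
    {ν : Measure β} [SFinite μ] [SFinite ν] {T : ℝ} {D : ℝ → Lp ℝ 2 μ} {f : ℝ → Lp ℝ 2 ν}
    (hD : MemLp D 2 (volume.restrict (Ioo 0 T))) (hf : ContinuousOn f (Icc 0 T)) :
    MemLp (fun s => tensor (D s) (f s)) 2 (volume.restrict (Ioo 0 T)) := by
  obtain ⟨C, hC⟩ := isCompact_Icc.exists_bound_of_continuousOn hf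
  have hm : AEStronglyMeasurable (fun s => tensor (D s) (f s)) (volume.restrict (Ioo 0 T)) :=
    ContinuousLinearMap.aestronglyMeasurable_comp₂ tensor hD.1
      (aestronglyMeasurable_Ioo_of_continuousOn hf)
  refine MemLp.of_le_mul (c := ‖(tensor : Lp ℝ 2 μ →L[ℝ] Lp ℝ 2 ν →L[ℝ] _)‖ * C) hD hm ?_
  filter_upwards [ae_restrict_mem measurableSet_Ioo] with s hs
  refine (tensor.le_opNorm₂ _ _).trans ?_
  rw [mul_right_comm]
  gcongr
  exact hC s (Ioo_subset_Icc_self hs)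

namespace LearningData

variable {d l N : ℕ} {S : LearningData d l N} {L K : ℝ≥0}

/-- The pairing of a parameter direction with the adjoint state. -/
lemma integral_inner_eq_of_curryLp {D f : ℝ → S.State} (hD : MemLp D 2 S.μT)
    (hf : ContinuousOn f (Icc 0 S.T)) {Da : S.BiasSpace} {Db : S.WeightSpace}
    (hDa : curryLp Da =ᵐ[S.μT] D)
    (hDb : curryLp (assocLp Db) =ᵐ[S.μT] fun s => tensor (D s) (f s))
    (α : S.BiasSpace) (β : S.WeightSpace) :
    ∫ s in Ioo 0 S.T, ⟪S.biasPath α s - S.weightPath β s (f s), D s⟫ = ⟪Da, α⟫ - ⟪Db, β⟫ := by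
  have ia : ⟪Da, α⟫ = ∫ s, ⟪S.biasPath α s, D s⟫ ∂S.μT := by
    rw [← integral_inner_curryLp]
    refine integral_congr_ae ?_
    filter_upwards [hDa] with s hs
    rw [hs, real_inner_comm, biasPath]
  have ib : ⟪Db, β⟫ = ∫ s, ⟪S.weightPath β s (f s), D s⟫ ∂S.μT := by
    rw [← assocLp.inner_map_map, ← integral_inner_curryLp]
    refine integral_congr_ae ?_
    filter_upwards [hDb] with s hs
    rw [hs, inner_tensor_left, real_inner_comm, weightPath]
  simp_rw [inner_sub_left]
  rw [ia, ib]
  exact integral_sub (integrable_inner_of_memLp (memLp_biasPath α) hD)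
    (integrable_inner_of_memLp (memLp_clm_apply (memLp_weightPath β) hf) hD)

variable [IsFiniteMeasure S.μY]

/-- The partial gradients with respect to the bias and the weight as square integrable functions. -/
lemma exists_bias_weight_gradient (hσ : LipschitzWith L S.σ) (hσd : Differentiable ℝ S.σ)
    (hT : 0 ≤ S.T) (a : S.BiasSpace) (b : S.WeightSpace) (j : Fin N) {r : ℝ → S.State}
    (hr : ContinuousOn r (Icc 0 S.T)) :
    ∃ (Da : S.BiasSpace) (Db : S.WeightSpace),
      (∀ᵐ s ∂S.μT, ∀ᵐ y ∂S.μY, Da (y, s) = deriv S.σ (S.xi a b j y s) * r s y) ∧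
      (∀ᵐ s ∂S.μT, ∀ᵐ y ∂S.μY, ∀ᵐ z ∂S.μY,
        Db (y, z, s) = S.forward a b j s z * deriv S.σ (S.xi a b j y s) * r s y) ∧
      ∀ (α : S.BiasSpace) (β : S.WeightSpace),
        ∫ s in Ioo 0 S.T, ⟪S.biasPath α s - S.weightPath β s (S.forward a b j s),
          nemytskiiDeriv hσ (S.biasPath a s - S.weightPath b s (S.forward a b j s)) (r s)⟫
        = ⟪Da, α⟫ - ⟪Db, β⟫ := by
  have hfc := (isForwardSolution_forward hσ hT a b j).continuousOn
  have hD : MemLp (fun s => nemytskiiDeriv hσ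
      (S.biasPath a s - S.weightPath b s (S.forward a b j s)) (r s)) 2 S.μT :=
    (memLp_linearization_apply (lipschitzWith_nemytskii hσ) (hasLineDerivAt_nemytskii hσ hσd)
      (memLp_biasPath a) (memLp_weightPath b) hfc hr).mono_exponent le_top
  have hDxi := coeFn_nemytskiiDeriv_xi hσ a b j
  -- Forward and backward states are only `L²(Y)`-valued paths, so their pointwise products need not
  -- be jointly measurable. Surjectivity of currying supplies genuine `L²` functions with the right
  -- sections.
  obtain ⟨Da, hDa⟩ := exists_curryLp_eq hD
  obtain ⟨Db', hDb'⟩ := exists_curryLp_eq (memLp_tensor_path hD hfc)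
  obtain ⟨Db, rfl⟩ := assocLp_surjective Db'
  refine ⟨Da, Db, ?_, ?_, integral_inner_eq_of_curryLp hD hfc hDa hDb'⟩
  · filter_upwards [hDa, coeFn_curryLp Da, hDxi] with s h1 h2 h3
    filter_upwards [h2, h3 (r s)] with y g1 g2
    rw [← g1, h1, ← g2]
  · filter_upwards [hDb', ae_section_assocLp Db, hDxi] with s h1 h2 h3
    rw [h1] at h2
    filter_upwards [Measure.ae_ae_of_ae_prod h2, h3 (r s),
      Measure.ae_ae_of_ae_prod (coeFn_tensor (nemytskiiDeriv hσ
        (S.biasPath a s - S.weightPath b s (S.forward a b j s)) (r s)) (S.forward a b j s))]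
      with y g1 g2 g3
    filter_upwards [g1, g3] with z k1 k2
    rw [← k1, k2]
    simp only
    rw [g2]
    ring

variable [IsFiniteMeasure S.μU]

/-- The derivative of the contribution of a single training pair to the loss. -/
lemma hasDerivAt_integral_sq (hσ : LipschitzWith L S.σ) (hσd : Differentiable ℝ S.σ)
    (hh : LipschitzWith K S.h) (hhd : Differentiable ℝ S.h) (hT : 0 ≤ S.T)
    {a : S.BiasSpace} {b : S.WeightSpace} {w : S.OutputWeightSpace} {μ : S.OutputBiasSpace}
    {j : Fin N} {r : ℝ → S.State} (hr : S.IsBackwardSolution (a, b, w, μ) j r)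
    (α : S.BiasSpace) (β : S.WeightSpace) (v : S.OutputWeightSpace) (φ : S.OutputBiasSpace) :
    HasDerivAt (fun ε : ℝ =>
        ∫ u, |S.predicted ((a, b, w, μ) + ε • (α, β, v, φ)) j u - S.P j u| ^ 2 ∂S.μU)
      (2 * ((∫ s in Ioo 0 S.T, ⟪S.biasPath α s - S.weightPath β s (S.forward a b j s),
          nemytskiiDeriv hσ (S.biasPath a s - S.weightPath b s (S.forward a b j s)) (r s)⟫)
        + ⟪tensor (residualLp hh (a, b, w, μ) j) (S.forward a b j S.T), v⟫
        + ⟪residualLp hh (a, b, w, μ) j, φ⟫)) 0 := by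
  obtain ⟨hrT, hr⟩ := (isBackwardSolution_iff hσ hh (a, b, w, μ) j r).1 hr
  obtain ⟨g, hg, hZ⟩ := exists_hasDerivAt_outputLp hσ hσd hT a α b β w v μ φ j
  simp_rw [integral_sq_eq_norm_sq hh]
  have hp0 : (a, b, w, μ) + (0 : ℝ) • (α, β, v, φ) = (a, b, w, μ) := by
    rw [zero_smul, add_zero]
  have h1 := ((hasDerivAt_comp_of_lipschitzWith (lipschitzWith_nemytskii hh) hZ
    (hasLineDerivAt_nemytskii hh hhd _ _)).sub_const (S.P j)).norm_sq
  rw [hp0] at h1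
  refine h1.congr_deriv ?_
  congr 1
  -- Moving `h'(Z)` onto `P_pre - P` gives the residual. Paired with the output variation, it yields
  -- the tensor term for `v`, the term for `φ`, and `⟪w* ρ, g(T)⟫ = ⟪r(T), g(T)⟫`, to which duality
  -- applies.
  rw [← inner_nemytskiiDeriv_left, ← residualLp, inner_add_right, inner_add_right,
    inner_tensor_left, ← ContinuousLinearMap.adjoint_inner_left (kernelOp w), ← hrT,
    real_inner_comm (g S.T) (r S.T), inner_linearized_adjoint hT (inner_nemytskiiDeriv_left hσ) hg hr]
  ring

end LearningData

end DeepIDE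

end

/-! ### Averaging over the training pairs. -/

namespace DeepIDE

lemma coeFn_smul_sum {α ι : Type*} [MeasurableSpace α] {μ : Measure α} [Fintype ι] (c : ℝ)
    (f : ι → Lp ℝ 2 μ) : ∀ᵐ x ∂μ, (c • ∑ i, f i : Lp ℝ 2 μ) x = c * ∑ i, f i x := by
  filter_upwards [Lp.coeFn_smul c (∑ i, f i), Lp.coeFn_finsetSum Finset.univ f] with x h1 h2
  rw [h1, Pi.smul_apply, h2, Finset.sum_apply, smul_eq_mul]

lemma ae_ae_ae_of_ae_prod {α β γ : Type*} [MeasurableSpace α] [MeasurableSpace β]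
    [MeasurableSpace γ] {μ : Measure α} {ν : Measure β} {ρ : Measure γ} [SFinite μ] [SFinite ν]
    [SFinite ρ] {p : α × β × γ → Prop} (h : ∀ᵐ x ∂μ.prod (ν.prod ρ), p x) :
    ∀ᵐ s ∂ρ, ∀ᵐ y ∂μ, ∀ᵐ z ∂ν, p (y, z, s) := by
  have h1 := (measurePreserving_prodAssoc μ ν ρ).quasiMeasurePreserving.ae h
  filter_upwards [ae_ae_of_ae_prod_right h1] with s hs
  exact Measure.ae_ae_of_ae_prod hs

end DeepIDE

theorem mainTheorem3 {d l N : ℕ} (hN : 0 < N) (S : DeepIDE.LearningData d l N)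
    (hY : IsOpen S.Y) (hYb : Bornology.IsBounded S.Y)
    (hU : IsOpen S.U) (hUb : Bornology.IsBounded S.U)
    (hT : 0 < S.T)
    (hσ : ∃ L, LipschitzWith L S.σ) (hσd : Differentiable ℝ S.σ)
    (hh : ∃ L, LipschitzWith L S.h) (hhd : Differentiable ℝ S.h) :
    -- the forward problems are uniquely solvable, so that the loss is well defined
    (∀ (a : S.BiasSpace) (b : S.WeightSpace) (j : Fin N),
      (∃ f, S.IsForwardSolution a b j f) ∧
      ∀ f g, S.IsForwardSolution a b j f → S.IsForwardSolution a b j g →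
        EqOn f g (Icc 0 S.T)) ∧
    ∀ (a : S.BiasSpace) (b : S.WeightSpace) (w : S.OutputWeightSpace) (μ : S.OutputBiasSpace),
      -- the backward problems are uniquely solvable
      (∀ j : Fin N,
        (∃ r, S.IsBackwardSolution (a, b, w, μ) j r) ∧
        ∀ r q, S.IsBackwardSolution (a, b, w, μ) j r → S.IsBackwardSolution (a, b, w, μ) j q →
          EqOn r q (Icc 0 S.T)) ∧
      ∀ r : Fin N → ℝ → S.State, (∀ j, S.IsBackwardSolution (a, b, w, μ) j (r j)) →
        ∃ (DaJ : S.BiasSpace) (DbJ : S.WeightSpace) (DwJ : S.OutputWeightSpace)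
          (DμJ : S.OutputBiasSpace),
          (∀ᵐ s ∂S.μT, ∀ᵐ y ∂S.μY,
            DaJ (y, s) = 1 / (N : ℝ) * ∑ j, deriv S.σ (S.xi a b j y s) * r j s y) ∧
          (∀ᵐ s ∂S.μT, ∀ᵐ y ∂S.μY, ∀ᵐ z ∂S.μY,
            DbJ (y, z, s) = -(1 / (N : ℝ) *
              ∑ j, S.forward a b j s z * deriv S.σ (S.xi a b j y s) * r j s y)) ∧
          (∀ᵐ u ∂S.μU, ∀ᵐ y ∂S.μY,
            DwJ (u, y) = 1 / (N : ℝ) *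
              ∑ j, (S.predicted (a, b, w, μ) j u - S.P j u) *
                deriv S.h (S.output (a, b, w, μ) j u) * S.forward a b j S.T y) ∧
          (∀ᵐ u ∂S.μU,
            DμJ u = 1 / (N : ℝ) *
              ∑ j, (S.predicted (a, b, w, μ) j u - S.P j u) *
                deriv S.h (S.output (a, b, w, μ) j u)) ∧
          -- `(DaJ, DbJ, DwJ, DμJ)` is the Gateaux derivative of the loss at `(a, b, w, μ)`
          ∀ (α : S.BiasSpace) (β : S.WeightSpace) (v : S.OutputWeightSpace)
            (φ : S.OutputBiasSpace),
            HasLineDerivAt ℝ S.loss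
              (inner ℝ DaJ α + inner ℝ DbJ β + inner ℝ DwJ v + inner ℝ DμJ φ)
              (a, b, w, μ) (α, β, v, φ) := by
  obtain ⟨L, hL⟩ := hσ
  obtain ⟨K, hK⟩ := hh
  -- Boundedness of the domains enters here: constants are then square integrable, as the Nemytskii
  -- operators require.
  have hfY : IsFiniteMeasure S.μY := ⟨by simpa using hYb.measure_lt_top⟩
  have hfU : IsFiniteMeasure S.μU := ⟨by simpa using hUb.measure_lt_top⟩
  refine ⟨fun a b j => ⟨⟨_, DeepIDE.LearningData.isForwardSolution_forward hL hT.le a b j⟩,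
    fun f g hf hg => DeepIDE.LearningData.IsForwardSolution.eqOn hL hf hg⟩,
    fun a b w μ => ⟨fun j => ⟨DeepIDE.LearningData.exists_isBackwardSolution hL hσd hK hT.le _ j,
      fun r q hr hq => DeepIDE.LearningData.IsBackwardSolution.eqOn hL hσd hK hr hq⟩,
    fun r hr => ?_⟩⟩
  choose Da Db hDa hDb hD using fun j =>
    DeepIDE.LearningData.exists_bias_weight_gradient hL hσd hT.le a b j (hr j).continuousOn
  set ρ : Fin N → S.OutputBiasSpace :=
    fun j => DeepIDE.LearningData.residualLp hK (a, b, w, μ) j with hρ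
  have hρc : ∀ j, ∀ᵐ u ∂S.μU, ρ j u = S.residual (a, b, w, μ) j u := fun j =>
    DeepIDE.LearningData.coeFn_residualLp hK (a, b, w, μ) j
  -- The minus sign reflects that `b` enters `ξ` negatively; `Db j` itself carries no sign.
  refine ⟨(1 / (N : ℝ)) • ∑ j, Da j, -((1 / (N : ℝ)) • ∑ j, Db j),
    (1 / (N : ℝ)) • ∑ j, DeepIDE.tensor (ρ j) (S.forward a b j S.T),
    (1 / (N : ℝ)) • ∑ j, ρ j, ?_, ?_, ?_, ?_, fun α β v φ => ?_⟩
  · filter_upwards [DeepIDE.ae_ae_of_ae_prod_right (DeepIDE.coeFn_smul_sum (1 / (N : ℝ)) Da),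
      ae_all_iff.2 hDa] with s h1 h2
    filter_upwards [h1, ae_all_iff.2 h2] with y g1 g2
    rw [g1]
    simp_rw [g2]
  · have h0 := DeepIDE.ae_ae_ae_of_ae_prod ((Lp.coeFn_neg ((1 / (N : ℝ)) • ∑ j, Db j)).and
      (DeepIDE.coeFn_smul_sum (1 / (N : ℝ)) Db))
    filter_upwards [h0, ae_all_iff.2 hDb] with s h1 h2
    filter_upwards [h1, ae_all_iff.2 h2] with y g1 g2
    filter_upwards [g1, ae_all_iff.2 g2] with z k1 k2
    rw [k1.1, Pi.neg_apply, k1.2]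
    simp_rw [k2]
  · filter_upwards [Measure.ae_ae_of_ae_prod (DeepIDE.coeFn_smul_sum (1 / (N : ℝ))
        fun j => DeepIDE.tensor (ρ j) (S.forward a b j S.T)),
      ae_all_iff.2 fun j => Measure.ae_ae_of_ae_prod
        (DeepIDE.coeFn_tensor (ρ j) (S.forward a b j S.T)), ae_all_iff.2 hρc] with u h1 h2 h3
    filter_upwards [h1, ae_all_iff.2 h2] with y g1 g2
    rw [g1]
    simp_rw [g2, h3]
    rfl
  · filter_upwards [DeepIDE.coeFn_smul_sum (1 / (N : ℝ)) ρ, ae_all_iff.2 hρc] with u h1 h2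
    rw [h1]
    simp_rw [h2]
    rfl
  · have h1 := fun j => DeepIDE.LearningData.hasDerivAt_integral_sq hL hσd hK hhd hT.le (hr j) α β v φ
    have h2 := (HasDerivAt.fun_sum fun j (_ : j ∈ Finset.univ) => h1 j).const_mul
      (1 / (2 * (N : ℝ)))
    refine HasDerivAt.congr_deriv h2 ?_
    simp_rw [hD]
    rw [← Finset.mul_sum, inner_neg_left, real_inner_smul_left, real_inner_smul_left,
      real_inner_smul_left, real_inner_smul_left, sum_inner, sum_inner, sum_inner, sum_inner,
      Finset.sum_add_distrib, Finset.sum_add_distrib, Finset.sum_sub_distrib]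
    have hN' : (N : ℝ) ≠ 0 := by exact_mod_cast hN.ne'
    field_simp
    ring
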